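/- Let $A$ and $V$ be nonnegative self-adjoint operators on a separable complex Hilbert space $\mathcal H$, let $\mathcal D\subseteq \operatorname{dom}(A)\cap\operatorname{dom}(V)$ be a linear subspace which is dense in $\mathcal H$, and suppose that for some $a,b>0$ $$(Vf,f)\le a(Af,f)+b\|f\|^2,\qquad f\in\mathcal D .$$ Put $\dot A=A|\mathcal D$ and $\dot H_\alpha=(A-\alpha V)|\mathcal D$ for $\alpha>0$; for $\alpha<1/a$ let $\hat H_\alpha$ be the Friedrichs extension of the semibounded symmetric operator $\dot H_\alpha$. For $\eta<0$ let $\mathcal N_\eta=\ker(\dot A^*-\eta)$. Let $\{V_n\}_{n\ge1}$ be a regularizing sequence of $V$: the $V_n$ are bounded nonnegative self-adjoint operators, $V_1\le V_2\le\dots\le V$, and $(V_nf,f)\to(Vf,f)$ for $f\in\mathcal D$. Suppose that it is admissible with respect to $\dot A$: there is some $\eta_0<0$ such that $\sup_n(V_nh,h)=+\infty$ for every $0\ne h\in\mathcal N_{\eta_0}$. Let $\eta<0$. For a self-adjoint extension $\tilde A\ge\eta$ of $\dot A$ let $\tilde\nu$ be its closed quadratic form, with $\operatorname{dom}(\tilde\nu)=\operatorname{dom}((\tilde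 A-\eta)^{1/2})$ and $\tilde\nu(f,f)=\|(\tilde A-\eta)^{1/2}f\|^2+\eta\|f\|^2$, and let $\hat\nu$ be the closed form of the Friedrichs extension $\hat A$ of $\dot A$. We say that $\tilde A$ corresponds to a nonnegative closed form $\tilde q$ on $\mathcal N_\eta$ (not necessarily densely defined) if $\operatorname{dom}(\hat\nu)\cap\operatorname{dom}(\tilde q)=\{0\}$, $\operatorname{dom}(\tilde\nu)=\operatorname{dom}(\hat\nu)+\operatorname{dom}(\tilde q)$, and $$\tilde\nu(g+h,g+h)=\hat\nu(g,g)+\tilde q(h,h)+2\eta\,\mathrm{Re}(g,h)+\eta(h,h),\qquad g\in\operatorname{dom}(\hat\nu),\ h\in\operatorname{dom}(\tilde q).$$ (1) Let $\tilde A\ge\eta$ be a self-adjoint extension of $\dot A$ which corresponds to a nonnegative closed form $\tilde q$ on $\mathcal N_\eta$ whose domain is a closed subspace of $\mathcal N_\eta$. Then there is $\alpha_0>0$ such that for all $0<\alpha<\alpha_0$ $$\operatorname*{s-lim}_{n\to\infty}(\tilde A-\alpha V_n-z)^{-1}=(\hat H_\alpha-z)^{-1},\qquad \operatorname{Im} z\ne0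 .$$ (2) In particular, this applies to the Krein (soft) extension $\check A$ of $\dot A$ with respect to the lower bound $\eta$, that is, the self-adjoint extension $\check A\ge\eta$ which corresponds to the zero form on all of $\mathcal N_\eta$: it exists, and there is $\alpha_0>0$ such that for all $0<\alpha<\alpha_0$ $$\operatorname*{s-lim}_{n\to\infty}(\check A-\alpha V_n-z)^{-1}=(\hat H_\alpha-z)^{-1},\qquad \operatorname{Im} z\ne0 .$$ -/

import Mathlib

open Filter Topology LinearPMap
open scoped ComplexConjugate

namespace SingularPerturbation

variable {H : Type*} [NormedAddCommGroup H] [InnerProductSpace ℂ H]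

/-- `T ≥ c` in the sense of quadratic forms on `dom T`. -/
def BoundedBelowBy (T : H →ₗ.[ℂ] H) (c : ℝ) : Prop :=
  ∀ x : T.domain, c * ‖(x : H)‖ ^ 2 ≤ (inner ℂ (T x) (x : H)).re

/-- `u` is a sequence in `dom T` which converges to `f` in `H` and is Cauchy with respect to the
quadratic form `x ↦ (T x, x)`. -/
def FormApprox (T : H →ₗ.[ℂ] H) (f : H) (u : ℕ → T.domain) : Prop :=
  Tendsto (fun n => (u n : H)) atTop (𝓝 f) ∧
    Tendsto (fun p : ℕ × ℕ =>
      (inner ℂ (T (u p.1 - u p.2)) ((u p.1 - u p.2 : T.domain) : H)).re) atTop (𝓝 0)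

/-- The domain of the closed quadratic form generated by a semibounded symmetric operator `T`, that
is, of the closure of `x ↦ (T x, x)`, `x ∈ dom T`. If `T` is self-adjoint and `T ≥ η`, this is
`dom ((T - η)^{1/2})`. For semibounded symmetric `T` the span adds nothing to the set of all limits,
see `mem_formDomain_iff`. -/
def formDomain (T : H →ₗ.[ℂ] H) : Submodule ℂ H :=
  Submodule.span ℂ {f | ∃ u, FormApprox T f u}

/-- The closed quadratic form generated by `T` takes the value `r` at `f` (that is, at the pair
`(f, f)`). If `T` is self-adjoint and `T ≥ η`, then
`r = ‖(T - η)^{1/2} f‖ ^ 2 + η * ‖f‖ ^ 2`. -/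
def HasFormValue (T : H →ₗ.[ℂ] H) (f : H) (r : ℝ) : Prop :=
  ∃ u, FormApprox T f u ∧
    Tendsto (fun n => (inner ℂ (T (u n)) (u n : H)).re) atTop (𝓝 r)

theorem mem_formDomain_iff {T : H →ₗ.[ℂ] H} {c : ℝ} (hc : BoundedBelowBy T c)
    {f : H} : f ∈ formDomain T ↔ ∃ u, FormApprox T f u := by
  refine ⟨fun hf => ?_, fun h => Submodule.subset_span h⟩
  induction hf using Submodule.span_induction with
  | mem x hx => exact hx
  | zero => exact ⟨fun _ => 0, by simp, by simp⟩
  | smul a x _ hx =>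
    obtain ⟨u, hu, hu'⟩ := hx
    refine ⟨fun n => a • u n, by simpa using hu.const_smul a, ?_⟩
    have := hu'.const_mul (‖a‖ ^ 2)
    rw [mul_zero] at this
    refine this.congr fun p => ?_
    simp only [← smul_sub, LinearPMap.map_smul, Submodule.coe_smul, inner_smul_left,
      inner_smul_right]
    rw [← mul_assoc, mul_comm a, Complex.conj_mul', ← Complex.ofReal_pow, Complex.re_ofReal_mul]
  | add x y _ _ hx hy =>
    obtain ⟨u, hu, hu'⟩ := hx
    obtain ⟨v, hv, hv'⟩ := hy
    refine ⟨fun n => u n + v n, by simpa using hu.add hv, ?_⟩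
    have dist0 : ∀ {w : ℕ → T.domain} {z : H},
        Tendsto (fun n => (w n : H)) atTop (𝓝 z) →
        Tendsto (fun p : ℕ × ℕ => c * ‖((w p.1 - w p.2 : T.domain) : H)‖ ^ 2)
          atTop (𝓝 0) := by
      intro w z hw
      have h1 : Tendsto (fun p : ℕ × ℕ => (w p.1 : H) - (w p.2 : H)) atTop (𝓝 (z - z)) := by
        rw [← prod_atTop_atTop_eq]
        exact (hw.comp tendsto_fst).sub (hw.comp tendsto_snd)
      simpa using (h1.norm.pow 2).const_mul c
    have hsum : Tendsto (fun n => ((u n + v n : T.domain) : H)) atTop (𝓝 (x + y)) := by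
      simpa using hu.add hv
    have lower := dist0 hsum
    have upper := ((hu'.sub (dist0 hu)).const_mul 2).add
      (((hv'.sub (dist0 hv)).const_mul 2).add lower)
    simp only [sub_zero, mul_zero, add_zero] at upper
    refine tendsto_of_tendsto_of_tendsto_of_le_of_le lower upper (fun p => hc _) fun p => ?_
    set s := u p.1 - u p.2 with hs
    set t := v p.1 - v p.2 with ht
    have e : u p.1 + v p.1 - (u p.2 + v p.2) = s + t := by rw [hs, ht]; abel
    have key := hc (s - t)
    have par := parallelogram_law_with_norm ℂ (s : H) (t : H)
    simp only [e]
    simp only [LinearPMap.map_sub, LinearPMap.map_add, Submodule.coe_sub, Submodule.coe_add,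
      inner_sub_left, inner_sub_right, inner_add_left, inner_add_right, Complex.sub_re,
      Complex.add_re] at key ⊢
    have par' := congrArg (fun r => c * r) par
    ring_nf at key par' ⊢
    linarith

/-- The Friedrichs extension of a densely defined semibounded symmetric operator: the restriction of
the adjoint to those elements of its domain which lie in the domain of the closed form. -/
noncomputable def friedrichs [CompleteSpace H] (T : H →ₗ.[ℂ] H) : H →ₗ.[ℂ] H :=
  (T†).domRestrict (formDomain T)

/-- The deficiency subspace `ker (T* - η)`. -/
noncomputable def deficiencySpace [CompleteSpace H] (T : H →ₗ.[ℂ] H) (η : ℝ) : Submodule ℂ H :=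
  (T†).graph.comap (LinearMap.prod LinearMap.id ((η : ℂ) • LinearMap.id))

/-- `(V n)` is a regularizing sequence of `V`: bounded nonnegative self-adjoint operators,
`V 0 ≤ V 1 ≤ ... ≤ V`, with `(V n f, f) → (V f, f)` for `f ∈ D`. -/
structure IsRegularizing (V : H →ₗ.[ℂ] H) (D : Submodule ℂ H) (Vn : ℕ → H →L[ℂ] H) : Prop where
  nonneg : ∀ n, (Vn n).IsPositive
  mono : ∀ n, ∀ f : H, (inner ℂ (Vn n f) f).re ≤ (inner ℂ (Vn (n + 1) f) f).re
  le : ∀ n, ∀ f : V.domain, (inner ℂ (Vn n f) (f : H)).re ≤ (inner ℂ (V f) (f : H)).re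
  tendsto : ∀ f : V.domain, (f : H) ∈ D →
    Tendsto (fun n => (inner ℂ (Vn n f) (f : H)).re) atTop (𝓝 (inner ℂ (V f) (f : H)).re)

/-- Admissibility with respect to the symmetric operator `T`: for some `η < 0`,
`sup_n (V n h, h) = ∞` for every nonzero `h ∈ ker (T* - η)`. -/
def IsAdmissible [CompleteSpace H] (T : H →ₗ.[ℂ] H) (Vn : ℕ → H →L[ℂ] H) : Prop :=
  ∃ η : ℝ, η < 0 ∧ ∀ h ∈ deficiencySpace T η, h ≠ 0 →
    ¬ BddAbove (Set.range fun n => (inner ℂ (Vn n h) h).re)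

/-- A nonnegative (Hermitian) form, not necessarily densely defined. -/
structure NonnegForm (H : Type*) [NormedAddCommGroup H] [InnerProductSpace ℂ H] where
  domain : Submodule ℂ H
  form : domain →ₗ⋆[ℂ] domain →ₗ[ℂ] ℂ
  symm : ∀ x y, conj (form x y) = form y x
  nonneg : ∀ x, 0 ≤ (form x x).re

/-- Closedness of a nonnegative form. -/
def NonnegForm.IsClosed (q : NonnegForm H) : Prop :=
  ∀ (u : ℕ → q.domain) (f : H), Tendsto (fun n => (u n : H)) atTop (𝓝 f) →
    Tendsto (fun p : ℕ × ℕ => (q.form (u p.1 - u p.2) (u p.1 - u p.2)).re) atTop (𝓝 0) →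
    ∃ hf : f ∈ q.domain,
      Tendsto (fun n => (q.form (u n - ⟨f, hf⟩) (u n - ⟨f, hf⟩)).re) atTop (𝓝 0)

/-- The form which is zero on the whole subspace `N`. -/
def NonnegForm.zeroOn (N : Submodule ℂ H) : NonnegForm H where
  domain := N
  form := 0
  symm := by simp
  nonneg := by simp

/-- `B` is a self-adjoint extension of `T` with `B ≥ η`. -/
structure IsSelfAdjointExtension [CompleteSpace H] (T : H →ₗ.[ℂ] H) (η : ℝ) (B : H →ₗ.[ℂ] H) :
    Prop where
  selfAdjoint : IsSelfAdjoint B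
  extends_le : T ≤ B
  bound : BoundedBelowBy B η

/-- The extension `B ≥ η` of `T` corresponds to the nonnegative closed form `q` on
`ker (T* - η)`: the form domain of `B` is the direct sum of the form domain of the Friedrichs
extension of `T` and of `dom q`, and
`ν_B(g + h, g + h) = ν_F(g, g) + q(h, h) + 2 η Re (g, h) + η (h, h)`. -/
structure CorrespondsTo [CompleteSpace H] (T : H →ₗ.[ℂ] H) (η : ℝ) (B : H →ₗ.[ℂ] H)
    (q : NonnegForm H) : Prop where
  domain_le : q.domain ≤ deficiencySpace T η
  closed : q.IsClosed
  disjoint : Disjoint (formDomain (friedrichs T)) q.domain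
  formDomain_eq : formDomain B = formDomain (friedrichs T) ⊔ q.domain
  value : ∀ (g : H) (r : ℝ), HasFormValue (friedrichs T) g r → ∀ h : q.domain,
    HasFormValue B (g + h)
      (r + (q.form h h).re + 2 * η * (inner ℂ g (h : H)).re + η * ‖(h : H)‖ ^ 2)

/-- `B` is the Krein (soft) extension of `T` with respect to the lower bound `η`: the one which
corresponds to the zero form on the whole of `ker (T* - η)`. -/
structure IsKreinExtension [CompleteSpace H] (T : H →ₗ.[ℂ] H) (η : ℝ) (B : H →ₗ.[ℂ] H) :
    Prop where
  extension : IsSelfAdjointExtension T η B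
  corresponds : CorrespondsTo T η B (NonnegForm.zeroOn (deficiencySpace T η))

/-- `R = (T - z)⁻¹` as an everywhere defined bounded operator. -/
def IsResolventAt (T : H →ₗ.[ℂ] H) (z : ℂ) (R : H →L[ℂ] H) : Prop :=
  (∀ f : H, ∃ x : T.domain, (x : H) = R f ∧ T x - z • (x : H) = f) ∧
    ∀ x : T.domain, R (T x - z • (x : H)) = x

/-- For all nonreal `z`, the resolvents `(T n - z)⁻¹` and `(S - z)⁻¹` exist as bounded operators,
and `(T n - z)⁻¹ → (S - z)⁻¹` strongly. -/
def StrongResolventConvergence (T : ℕ → H →ₗ.[ℂ] H) (S : H →ₗ.[ℂ] H) : Prop :=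
  ∀ z : ℂ, z.im ≠ 0 → ∃ (R : ℕ → H →L[ℂ] H) (R' : H →L[ℂ] H),
    (∀ n, IsResolventAt (T n) z (R n)) ∧ IsResolventAt S z R' ∧
      ∀ f : H, Tendsto (fun n => R n f) atTop (𝓝 (R' f))

/-- `B - α W` for a bounded operator `W`; its domain is `dom B`. -/
noncomputable def subBounded (B : H →ₗ.[ℂ] H) (α : ℝ) (W : H →L[ℂ] H) : H →ₗ.[ℂ] H :=
  B - ((α : ℂ) • W).toLinearMap.toPMap ⊤

/-- The operator `(A - α V)|D`. -/
noncomputable def singularOp (A V : H →ₗ.[ℂ] H) (D : Submodule ℂ H) (α : ℝ) : H →ₗ.[ℂ] H :=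
  (A - (α : ℂ) • V).domRestrict D

end SingularPerturbation

open SingularPerturbation

-- Let `E` be the completion of `D` for the inner product `(A x, y) - η (x, y)`, embedded in `H` by
-- `ι`; its image is the form domain of the Friedrichs extension, and it meets `N_η` only in `0`.
-- For fixed `f`, split the solution `u_n` of `(B - α V_n - z) u_n = f` as `ι g_n + h_n` with `h_n ∈
-- N_η`.
--
-- The form `q` is bounded because its domain is closed (closed graph theorem). The equation tested
-- against `u_n` controls `α (V_n u_n, u_n)` by `‖g_n‖²` and `‖h_n‖²`; tested against `ι g_n`, it
-- controls `‖g_n‖²` by `α (V_n u_n, ι g_n)`. Since the `V_n` are uniformly bounded on `E`,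
-- Cauchy-Schwarz and small `α` close the loop, and `g_n`, `h_n` and `(V_n u_n, u_n)` stay bounded
-- (`exists_a_priori_bound`).
--
-- Along any ultrafilter `g_n` and `h_n` have weak limits `e` and `k`. Monotonicity of `V_n` bounds
-- `(V_m (ι e + k), ι e + k)`, hence `(V_m k, k)`, uniformly in `m`, and admissibility (transported
-- to the parameter `η` by `IsAdmissible.eq_zero`) forces `k = 0`. The part of the form domain
-- specific to `B` therefore disappears. Testing against `φ ∈ D` and passing to the limit
-- (`IsFormSpace.limit_eq_inner_potential`) identifies `ι e` with the Friedrichs resolvent applied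
-- to `f`. Weak convergence becomes strong because `Im z ‖R f‖² = -Im (R f, f)` for resolvents of
-- symmetric operators.
--
-- The Krein extension is built from its form space `{(g, x) : x - ι g ∈ N_η} ⊆ E ⊕ H`.

universe u

namespace SingularPerturbation

/-- A module with a positive definite inner product embeds densely and isometrically into a Hilbert
space. -/
theorem exists_hilbert_completion {M : Type u} [AddCommGroup M] [Module ℂ M]
    (c : InnerProductSpace.Core ℂ M) :
    ∃ (E : Type u) (_ : NormedAddCommGroup E) (_ : InnerProductSpace ℂ E) (_ : CompleteSpace E)
      (j : M →ₗ[ℂ] E), DenseRange j ∧ ∀ x y, inner ℂ (j x) (j y) = c.inner x y := by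
  let _ : NormedAddCommGroup M := c.toNormedAddCommGroup
  let _ : InnerProductSpace ℂ M := InnerProductSpace.ofCore c.toCore
  refine ⟨UniformSpace.Completion M, inferInstance, inferInstance, inferInstance,
    (UniformSpace.Completion.toComplL (𝕜 := ℂ) (E := M)).toLinearMap,
    UniformSpace.Completion.denseRange_coe, fun x y => ?_⟩
  exact UniformSpace.Completion.inner_coe x y

/-! ### Form completions, the Friedrichs extension and its resolvent. -/

section FormSpace

variable {H : Type*} [NormedAddCommGroup H] [InnerProductSpace ℂ H]
variable {E : Type*} [NormedAddCommGroup E] [InnerProductSpace ℂ E]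

/-- The Hilbert space `E`, embedded into `H` by `ι`, is the completion of `dom T` with respect to
the inner product `(T x, y) + κ (x, y)`. -/
structure IsFormSpace (T : H →ₗ.[ℂ] H) (κ : ℝ) (ι : E →L[ℂ] H) (j : T.domain →ₗ[ℂ] E) :
    Prop where
  dense : DenseRange j
  embed : ∀ x, ι (j x) = x
  inner_eq : ∀ x y, inner ℂ (j x) (j y) = inner ℂ (T x) (y : H) + κ * inner ℂ (x : H) (y : H)
  injective : Function.Injective ι

/-- `S = G⁻¹ - κ`. -/
def IsShiftedInverse (S : H →ₗ.[ℂ] H) (κ : ℝ) (G : H →L[ℂ] H) : Prop :=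
  ∀ x y, (x, y) ∈ S.graph ↔ G (y + (κ : ℂ) • x) = x

variable {T : H →ₗ.[ℂ] H} {κ : ℝ} {ι : E →L[ℂ] H} {j : T.domain →ₗ[ℂ] E}

theorem re_inner_self_real (x : H) : (inner ℂ x x).re = ‖x‖ ^ 2 := by
  rw [inner_self_eq_norm_sq_to_K]
  norm_cast

theorem IsFormSpace.norm_sq (h : IsFormSpace T κ ι j) (x : T.domain) :
    ‖j x‖ ^ 2 = (inner ℂ (T x) (x : H)).re + κ * ‖(x : H)‖ ^ 2 := by
  rw [← re_inner_self_real, h.inner_eq, Complex.add_re, Complex.re_ofReal_mul, re_inner_self_real]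

theorem IsFormSpace.formApprox_of_tendsto (h : IsFormSpace T κ ι j) {u : ℕ → T.domain} {e : E}
    (hu : Tendsto (fun n => j (u n)) atTop (𝓝 e)) : FormApprox T (ι e) u := by
  have h1 : Tendsto (fun n => (u n : H)) atTop (𝓝 (ι e)) :=
    ((ι.continuous.tendsto e).comp hu).congr fun n => h.embed _
  refine ⟨h1, ?_⟩
  have h2 : Tendsto (fun p : ℕ × ℕ => j (u p.1) - j (u p.2)) atTop (𝓝 (e - e)) := by
    rw [← prod_atTop_atTop_eq]
    exact (hu.comp tendsto_fst).sub (hu.comp tendsto_snd)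
  have h3 : Tendsto (fun p : ℕ × ℕ => (u p.1 : H) - u p.2) atTop (𝓝 (ι e - ι e)) := by
    rw [← prod_atTop_atTop_eq]
    exact (h1.comp tendsto_fst).sub (h1.comp tendsto_snd)
  have h4 := (h2.norm.pow 2).sub ((h3.norm.pow 2).const_mul κ)
  simp only [sub_self, norm_zero, ne_eq, OfNat.ofNat_ne_zero, not_false_eq_true, zero_pow,
    mul_zero] at h4
  refine h4.congr fun p => ?_
  rw [← _root_.map_sub, h.norm_sq, Submodule.coe_sub]
  ring

theorem IsFormSpace.exists_tendsto (h : IsFormSpace T κ ι j) (e : E) :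
    ∃ u : ℕ → T.domain, Tendsto (fun n => j (u n)) atTop (𝓝 e) := by
  obtain ⟨v, hv, hv'⟩ := mem_closure_iff_seq_limit.1 (h.dense e)
  choose u hu using hv
  exact ⟨u, by simpa only [hu] using hv'⟩

/-- The `E`-norm differs from the form only by `κ ‖·‖²`, which vanishes on differences of an
`H`-convergent sequence; so form-Cauchy means Cauchy in `E`. -/
theorem IsFormSpace.tendsto_of_formApprox [CompleteSpace E] (h : IsFormSpace T κ ι j)
    {u : ℕ → T.domain} {f : H} (hu : FormApprox T f u) :
    ∃ e, ι e = f ∧ Tendsto (fun n => j (u n)) atTop (𝓝 e) := by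
  have h3 : Tendsto (fun p : ℕ × ℕ => (u p.1 : H) - u p.2) atTop (𝓝 (f - f)) := by
    rw [← prod_atTop_atTop_eq]
    exact (hu.1.comp tendsto_fst).sub (hu.1.comp tendsto_snd)
  have h4 := hu.2.add ((h3.norm.pow 2).const_mul κ)
  simp only [sub_self, norm_zero, ne_eq, OfNat.ofNat_ne_zero, not_false_eq_true, zero_pow,
    mul_zero, add_zero] at h4
  have h5 : Tendsto (fun p : ℕ × ℕ => ‖j (u p.1) - j (u p.2)‖ ^ 2) atTop (𝓝 0) := by
    refine h4.congr fun p => ?_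
    rw [← _root_.map_sub, h.norm_sq, Submodule.coe_sub]
  have hc : CauchySeq fun n => j (u n) := by
    rw [cauchySeq_iff_tendsto_dist_atTop_0]
    have := (Real.continuous_sqrt.tendsto 0).comp h5
    simp only [Real.sqrt_zero] at this
    refine this.congr fun p => ?_
    simp [dist_eq_norm, Real.sqrt_sq]
  obtain ⟨e, he⟩ := cauchySeq_tendsto_of_complete hc
  refine ⟨e, ?_, he⟩
  exact tendsto_nhds_unique (((ι.continuous.tendsto e).comp he).congr fun n => h.embed _) hu.1

theorem IsFormSpace.mem_formDomain_iff [CompleteSpace E] (h : IsFormSpace T κ ι j) {f : H} :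
    f ∈ formDomain T ↔ ∃ e, ι e = f := by
  constructor
  · intro hf
    have : formDomain T ≤ LinearMap.range ι.toLinearMap := by
      refine Submodule.span_le.2 ?_
      rintro x ⟨u, hu⟩
      obtain ⟨e, he, -⟩ := h.tendsto_of_formApprox hu
      exact ⟨e, he⟩
    exact this hf
  · rintro ⟨e, rfl⟩
    obtain ⟨u, hu⟩ := h.exists_tendsto e
    exact Submodule.subset_span ⟨u, h.formApprox_of_tendsto hu⟩

theorem IsFormSpace.tendsto_value (h : IsFormSpace T κ ι j) {u : ℕ → T.domain} {e : E}
    (hu : Tendsto (fun n => j (u n)) atTop (𝓝 e)) :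
    Tendsto (fun n => (inner ℂ (T (u n)) (u n : H)).re) atTop
      (𝓝 (‖e‖ ^ 2 - κ * ‖ι e‖ ^ 2)) := by
  have h1 := (h.formApprox_of_tendsto hu).1
  refine ((hu.norm.pow 2).sub ((h1.norm.pow 2).const_mul κ)).congr fun n => ?_
  rw [h.norm_sq]
  ring

theorem IsFormSpace.hasFormValue_iff [CompleteSpace E] (h : IsFormSpace T κ ι j) {f : H} {r : ℝ} :
    HasFormValue T f r ↔ ∃ e, ι e = f ∧ r = ‖e‖ ^ 2 - κ * ‖f‖ ^ 2 := by
  constructor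
  · rintro ⟨u, hu, hr⟩
    obtain ⟨e, rfl, he⟩ := h.tendsto_of_formApprox hu
    exact ⟨e, rfl, tendsto_nhds_unique hr (h.tendsto_value he)⟩
  · rintro ⟨e, rfl, rfl⟩
    obtain ⟨u, hu⟩ := h.exists_tendsto e
    exact ⟨u, h.formApprox_of_tendsto hu, h.tendsto_value hu⟩

/-- Stated without the full `IsFormSpace` because the injectivity of `ι` is itself deduced from this
identity. -/
theorem inner_right_of_dense {ι : E →L[ℂ] H} {j : T.domain →ₗ[ℂ] E} (hj : DenseRange j)
    (hι : ∀ x, ι (j x) = x)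
    (hi : ∀ x y, inner ℂ (j x) (j y) = inner ℂ (T x) (y : H) + κ * inner ℂ (x : H) (y : H))
    (x : T.domain) (e : E) :
    inner ℂ (j x) e = inner ℂ (T x + (κ : ℂ) • (x : H)) (ι e) := by
  have : (fun e => inner ℂ (j x) e) = fun e => inner ℂ (T x + (κ : ℂ) • (x : H)) (ι e) := by
    refine hj.equalizer (by fun_prop) (by fun_prop) (funext fun y => ?_)
    simp only [Function.comp_apply, hi, hι, inner_add_left, inner_smul_left, Complex.conj_ofReal]
  exact congrFun this e

theorem IsFormSpace.inner_right (h : IsFormSpace T κ ι j) (x : T.domain) (e : E) :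
    inner ℂ (j x) e = inner ℂ (T x + (κ : ℂ) • (x : H)) (ι e) :=
  inner_right_of_dense h.dense h.embed h.inner_eq x e

/-- The completion of the domain of a semibounded symmetric operator exists. -/
theorem exists_isFormSpace {H : Type u} [NormedAddCommGroup H] [InnerProductSpace ℂ H]
    [CompleteSpace H] {T : H →ₗ.[ℂ] H} (hs : T.IsFormalAdjoint T)
    {c κ : ℝ} (hc : BoundedBelowBy T c) (hκ : 0 < c + κ) :
    ∃ (E : Type u) (_ : NormedAddCommGroup E) (_ : InnerProductSpace ℂ E) (_ : CompleteSpace E)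
      (ι : E →L[ℂ] H) (j : T.domain →ₗ[ℂ] E), IsFormSpace T κ ι j := by
  have low : ∀ x : T.domain, (c + κ) * ‖(x : H)‖ ^ 2 ≤
      (inner ℂ (T x) (x : H) + κ * inner ℂ (x : H) (x : H)).re := by
    intro x
    rw [Complex.add_re, Complex.re_ofReal_mul, re_inner_self_real]
    linarith [hc x]
  let core : InnerProductSpace.Core ℂ T.domain :=
    { inner := fun x y => inner ℂ (T x) (y : H) + κ * inner ℂ (x : H) (y : H)
      conj_inner_symm := fun x y => by
        simp only [_root_.map_add, map_mul, Complex.conj_ofReal, inner_conj_symm]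
        rw [hs x y]
      re_inner_nonneg := fun x => le_trans (by positivity) (low x)
      add_left := fun x y z => by
        simp only [LinearPMap.map_add, Submodule.coe_add, inner_add_left]
        ring
      smul_left := fun x y r => by
        simp only [LinearPMap.map_smul, Submodule.coe_smul, inner_smul_left]
        ring
      definite := fun x hx => by
        have := low x
        rw [hx, Complex.zero_re] at this
        have h2 : ‖(x : H)‖ ^ 2 ≤ 0 := by
          by_contra! h
          nlinarith
        have h3 : (x : H) = 0 := by
          rw [← norm_eq_zero]
          exact pow_eq_zero_iff two_ne_zero |>.1 (le_antisymm h2 (by positivity))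
        exact Subtype.ext h3 }
  obtain ⟨E, i1, i2, i3, j, hj, hinner⟩ := exists_hilbert_completion core
  have hinner' : ∀ x y, inner ℂ (j x) (j y) =
      inner ℂ (T x) (y : H) + κ * inner ℂ (x : H) (y : H) := hinner
  have hnorm : ∀ x : T.domain, ‖T.domain.subtype x‖ ≤ (Real.sqrt (c + κ))⁻¹ * ‖j x‖ := by
    intro x
    have h1 := low x
    rw [← hinner', re_inner_self_real] at h1
    have h0 : 0 < Real.sqrt (c + κ) := Real.sqrt_pos.2 hκ
    rw [← div_eq_inv_mul, le_div_iff₀ h0]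
    refine le_of_sq_le_sq ?_ (norm_nonneg _)
    rw [mul_pow, Real.sq_sqrt hκ.le, mul_comm]
    exact h1
  let ι : E →L[ℂ] H := T.domain.subtype.extendOfNorm j
  have hι : ∀ x, ι (j x) = x := fun x => LinearMap.extendOfNorm_eq hj ⟨_, hnorm⟩ x
  refine ⟨E, i1, i2, i3, ι, j, hj, hι, hinner', ?_⟩
  -- This is closability of the form: if `ι e = 0`, then `e` is orthogonal to the dense range of
  -- `j`.
  rw [injective_iff_map_eq_zero]
  intro e he
  have key := fun x : T.domain => inner_right_of_dense hj hι hinner' x e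
  have h0 : (fun y => inner ℂ y e) = fun _ => (0 : ℂ) :=
    hj.equalizer (by fun_prop) (by fun_prop) (funext fun x => by simp [key, he])
  exact inner_self_eq_zero.1 (congrFun h0 e)

theorem mem_graph_domRestrict_iff {T : H →ₗ.[ℂ] H} {S : Submodule ℂ H} {x y : H} :
    (x, y) ∈ (T.domRestrict S).graph ↔ x ∈ S ∧ (x, y) ∈ T.graph := by
  simp only [LinearPMap.mem_graph_iff]
  constructor
  · rintro ⟨⟨z, hz⟩, rfl, rfl⟩
    exact ⟨hz.1, ⟨z, hz.2⟩, rfl, (domRestrict_apply rfl).symm⟩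
  · rintro ⟨hx, ⟨z, hz⟩, rfl, rfl⟩
    exact ⟨⟨z, hx, hz⟩, rfl, domRestrict_apply rfl⟩

variable [CompleteSpace H]

theorem mem_graph_adjoint_iff {T : H →ₗ.[ℂ] H} (hT : Dense (T.domain : Set H)) {x y : H} :
    (x, y) ∈ T†.graph ↔ ∀ z : T.domain, inner ℂ y (z : H) = inner ℂ x (T z) := by
  constructor
  · intro h z
    obtain ⟨x', hx, hy⟩ := (T†).mem_graph_iff.1 h
    dsimp only at hx hy
    rw [← hx, ← hy]
    exact adjoint_isFormalAdjoint hT x' z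
  · intro h
    have hx := mem_adjoint_domain_of_exists x ⟨y, h⟩
    exact (T†).mem_graph_iff.2 ⟨⟨x, hx⟩, rfl, adjoint_apply_eq hT _ h⟩

/-- The Friedrichs extension is the operator of the closed form. -/
theorem IsFormSpace.friedrichs_isShiftedInverse [CompleteSpace E] (h : IsFormSpace T κ ι j)
    (hT : Dense (T.domain : Set H)) :
    IsShiftedInverse (friedrichs T) κ (ι ∘L ι.adjoint) := by
  intro x y
  rw [friedrichs, mem_graph_domRestrict_iff, h.mem_formDomain_iff, mem_graph_adjoint_iff hT]
  -- The adjoint relation tested on `dom T` is an identity of inner products in `E`; density of `j`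
  -- turns it into one equation for `e`.
  have adj : ∀ e : E, (∀ z : T.domain, inner ℂ y (z : H) = inner ℂ (ι e) (T z)) ↔
      ι.adjoint (y + (κ : ℂ) • ι e) = e := by
    intro e
    have e1 : ∀ z : T.domain, inner ℂ y (z : H) = inner ℂ (ι e) (T z) ↔
        inner ℂ (ι.adjoint (y + (κ : ℂ) • ι e)) (j z) = inner ℂ e (j z) := by
      intro z
      rw [← inner_conj_symm e, h.inner_right, inner_conj_symm, ContinuousLinearMap.adjoint_inner_left,
        h.embed]
      simp only [inner_add_left, inner_add_right, inner_smul_left, inner_smul_right,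
        Complex.conj_ofReal, add_left_inj]
    simp only [e1]
    constructor
    · intro hz
      refine ext_inner_right ℂ fun v => ?_
      have : (fun v => inner ℂ (ι.adjoint (y + (κ : ℂ) • ι e)) v) = fun v => inner ℂ e v :=
        h.dense.equalizer (by fun_prop) (by fun_prop) (funext hz)
      exact congrFun this v
    · intro hz z
      rw [hz]
  constructor
  · rintro ⟨⟨e, rfl⟩, hz⟩
    rw [ContinuousLinearMap.comp_apply, (adj e).1 hz]
  · intro hx
    refine ⟨⟨_, hx⟩, ?_⟩
    have hx' : ι (ι.adjoint (y + (κ : ℂ) • x)) = x := hx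
    have := (adj (ι.adjoint (y + (κ : ℂ) • x))).2 (by rw [hx'])
    rwa [hx'] at this

/-- With `ζ = κ + z`, `S - z = G⁻¹ - ζ`, so the resolvent is `G (1 - ζ G)⁻¹`; the inverse exists
since `ζ⁻¹` is nonreal and `G` has real spectrum. -/
theorem IsShiftedInverse.exists_resolvent {S : H →ₗ.[ℂ] H} {G : H →L[ℂ] H}
    (h : IsShiftedInverse S κ G) (hG : IsSelfAdjoint G) {z : ℂ} (hz : z.im ≠ 0) :
    ∃ R : H →L[ℂ] H, IsResolventAt S z R := by
  set ζ : ℂ := κ + z with hζ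
  have him : ζ.im = z.im := by simp [hζ]
  have hζ0 : ζ ≠ 0 := fun h0 => hz (by rw [← him, h0, Complex.zero_im])
  have hu : IsUnit (1 - ζ • G) := by
    have hs : ζ⁻¹ ∉ spectrum ℂ G := by
      intro hmem
      have := hG.im_eq_zero_of_mem_spectrum hmem
      rw [Complex.inv_im, div_eq_zero_iff, neg_eq_zero, him] at this
      rcases this with h1 | h1
      · exact hz h1
      · exact hζ0 (Complex.normSq_eq_zero.1 h1)
    rw [spectrum.notMem_iff] at hs
    have := hs.smul (Units.mk0 ζ hζ0)
    convert this using 1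
    simp [Units.smul_def, smul_sub, Algebra.algebraMap_eq_smul_one, smul_smul, hζ0]
  obtain ⟨U, hU⟩ := hu
  have hright : ∀ f : H, (1 - ζ • G) ((↑U⁻¹ : H →L[ℂ] H) f) = f := by
    intro f
    rw [← hU, ← mul_apply_eq_comp, Units.mul_inv]
    rfl
  have hleft : ∀ f : H, (↑U⁻¹ : H →L[ℂ] H) ((1 - ζ • G) f) = f := by
    intro f
    rw [← hU, ← mul_apply_eq_comp, Units.inv_mul]
    rfl
  refine ⟨G ∘L (↑U⁻¹ : H →L[ℂ] H), fun f => ?_, fun x => ?_⟩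
  · set w := (↑U⁻¹ : H →L[ℂ] H) f with hw
    have hmem : (G w, w - (κ : ℂ) • G w) ∈ S.graph := (h _ _).2 (by simp)
    obtain ⟨x, hx, hy⟩ := S.mem_graph_iff.1 hmem
    dsimp only at hx hy
    refine ⟨x, hx, ?_⟩
    have := hright f
    rw [← hw] at this
    simp only [_root_.sub_apply, one_apply_eq_self,
      _root_.smul_apply, hζ] at this
    rw [hx, hy, ← this]
    module
  · have hx := (h x (S x)).1 (S.mem_graph x)
    set w := S x + (κ : ℂ) • (x : H) with hw
    have e : S x - z • (x : H) = (1 - ζ • G) w := by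
      simp only [_root_.sub_apply, one_apply_eq_self,
        _root_.smul_apply, hx, hζ]
      rw [hw]
      module
    rw [e, ContinuousLinearMap.comp_apply, hleft, hx]

end FormSpace

/-! ### Cauchy-Schwarz for forms, weak compactness, adjoints of embeddings. -/

section AuxiliaryHilbert

/-- The Cauchy-Schwarz inequality for the nonnegative hermitian form `(S x, i y)`. -/
theorem norm_inner_sq_le {M H : Type*} [AddCommGroup M] [Module ℂ M] [NormedAddCommGroup H]
    [InnerProductSpace ℂ H] (S i : M →ₗ[ℂ] H) (hs : ∀ x y, inner ℂ (S x) (i y) = inner ℂ (i x) (S y))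
    (h0 : ∀ x, 0 ≤ (inner ℂ (S x) (i x)).re) (x y : M) :
    ‖inner ℂ (S x) (i y)‖ ^ 2 ≤ (inner ℂ (S x) (i x)).re * (inner ℂ (S y) (i y)).re := by
  let core : PreInnerProductSpace.Core ℂ M :=
    { inner := fun x y => inner ℂ (S x) (i y)
      conj_inner_symm := fun x y => by rw [inner_conj_symm, hs]
      re_inner_nonneg := h0
      add_left := fun x y z => by simp only [_root_.map_add, inner_add_left]
      smul_left := fun x y r => by simp only [_root_.map_smul, inner_smul_left] }
  have h : ‖inner ℂ (S x) (i y)‖ * ‖inner ℂ (S y) (i x)‖ ≤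
      (inner ℂ (S x) (i x)).re * (inner ℂ (S y) (i y)).re :=
    InnerProductSpace.Core.inner_mul_inner_self_le (c := core) x y
  have e : ‖inner ℂ (S y) (i x)‖ = ‖inner ℂ (S x) (i y)‖ := by
    rw [← inner_conj_symm, RCLike.norm_conj, hs]
  rw [e] at h
  rwa [sq]

variable {H : Type*} [NormedAddCommGroup H] [InnerProductSpace ℂ H]

theorem _root_.ContinuousLinearMap.IsPositive.norm_inner_sq_le {W : H →L[ℂ] H} (hW : W.IsPositive) (x y : H) :
    ‖inner ℂ (W x) y‖ ^ 2 ≤ (inner ℂ (W x) x).re * (inner ℂ (W y) y).re :=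
  SingularPerturbation.norm_inner_sq_le W.toLinearMap LinearMap.id
    (fun x y => hW.isSymmetric x y) (fun x => hW.re_inner_nonneg_left x) x y

/-- Bounded sequences in a Hilbert space converge weakly along ultrafilters. -/
theorem exists_weak_limit [CompleteSpace H] (l : Ultrafilter ℕ) {x : ℕ → H} {C : ℝ}
    (hx : ∀ n, ‖x n‖ ≤ C) :
    ∃ e, ∀ y, Tendsto (fun n => inner ℂ (x n) y) l (𝓝 (inner ℂ e y)) := by
  have hb : ∀ y n, ‖inner ℂ (x n) y‖ ≤ C * ‖y‖ := fun y n =>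
    (norm_inner_le_norm _ _).trans (by gcongr; exact hx n)
  -- An ultrafilter converges in every compact disc, so all matrix elements converge at once,
  -- without extracting subsequences; Riesz then represents the limit functional.
  have hex : ∀ y, ∃ c : ℂ, ‖c‖ ≤ C * ‖y‖ ∧ Tendsto (fun n => inner ℂ (x n) y) l (𝓝 c) := by
    intro y
    have hc : IsCompact (Metric.closedBall (0 : ℂ) (C * ‖y‖)) := isCompact_closedBall _ _
    obtain ⟨c, hc1, hc2⟩ := hc.ultrafilter_le_nhds (l.map fun n => inner ℂ (x n) y) (by
      rw [Ultrafilter.coe_map, le_principal_iff, mem_map]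
      exact Filter.univ_mem' fun n => by simpa using hb y n)
    exact ⟨c, by simpa using hc1, hc2⟩
  choose c hc1 hc2 using hex
  let φ : H →ₗ[ℂ] ℂ :=
    { toFun := c
      map_add' := fun y y' => tendsto_nhds_unique (hc2 _)
        (((hc2 y).add (hc2 y')).congr fun n => (inner_add_right _ _ _).symm)
      map_smul' := fun r y => tendsto_nhds_unique (hc2 _)
        (((hc2 y).const_mul r).congr fun n => (inner_smul_right _ _ _).symm) }
  refine ⟨(InnerProductSpace.toDual ℂ H).symm (φ.mkContinuous C hc1), fun y => ?_⟩
  rw [InnerProductSpace.toDual_symm_apply]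
  exact hc2 y

variable {E : Type*} [NormedAddCommGroup E] [InnerProductSpace ℂ E] [CompleteSpace E]
  [CompleteSpace H]

theorem denseRange_adjoint {ι : E →L[ℂ] H} (hι : Function.Injective ι) :
    DenseRange ι.adjoint := by
  have h := ContinuousLinearMap.orthogonal_range ι.adjoint
  rw [ContinuousLinearMap.adjoint_adjoint, LinearMap.ker_eq_bot.2 hι,
    ← Submodule.topologicalClosure_eq_top_iff, ← Submodule.dense_iff_topologicalClosure_eq_top] at h
  exact h

theorem injective_adjoint {ι : E →L[ℂ] H} (hι : DenseRange ι) :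
    Function.Injective ι.adjoint := by
  rw [injective_iff_map_eq_zero]
  intro y hy
  have : (fun x => inner ℂ y x) = fun _ => (0 : ℂ) :=
    hι.equalizer (by fun_prop) (by fun_prop) (funext fun e => by
      simp [← ContinuousLinearMap.adjoint_inner_left, hy])
  exact inner_self_eq_zero.1 (congrFun this y)

end AuxiliaryHilbert

/-! ### Perturbation by a bounded operator. -/

section Algebra

variable {H : Type*} [NormedAddCommGroup H] [InnerProductSpace ℂ H]

theorem mem_formDomain_of_mem_domain {T : H →ₗ.[ℂ] H} (x : T.domain) : (x : H) ∈ formDomain T :=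
  Submodule.subset_span ⟨fun _ => x, by simp [FormApprox]⟩

theorem mem_graph_subBounded_iff {B : H →ₗ.[ℂ] H} {α : ℝ} {W : H →L[ℂ] H} {x y : H} :
    (x, y) ∈ (subBounded B α W).graph ↔ (x, y + (α : ℂ) • W x) ∈ B.graph := by
  simp only [LinearPMap.mem_graph_iff]
  constructor
  · rintro ⟨⟨z, hz⟩, rfl, rfl⟩
    refine ⟨⟨z, hz.1⟩, rfl, ?_⟩
    simp [subBounded, LinearPMap.sub_apply]
  · rintro ⟨⟨z, hz⟩, rfl, hy⟩
    refine ⟨⟨z, hz, Submodule.mem_top⟩, rfl, ?_⟩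
    rw [← sub_eq_iff_eq_add] at hy
    rw [← hy]
    simp [subBounded, LinearPMap.sub_apply]

theorem subBounded_boundedBelow {B : H →ₗ.[ℂ] H} {c : ℝ} (hB : BoundedBelowBy B c) {α : ℝ}
    (hα : 0 ≤ α) (W : H →L[ℂ] H) : BoundedBelowBy (subBounded B α W) (c - α * ‖W‖) := by
  rintro ⟨x, hx⟩
  have h1 : subBounded B α W ⟨x, hx⟩ = B ⟨x, hx.1⟩ - (α : ℂ) • W x := by
    simp [subBounded, LinearPMap.sub_apply]
  have h2 := hB ⟨x, hx.1⟩
  have h3 : (inner ℂ (W x) x).re ≤ ‖W‖ * ‖x‖ ^ 2 := by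
    refine (Complex.re_le_norm _).trans ((norm_inner_le_norm _ _).trans ?_)
    rw [sq, ← mul_assoc]
    gcongr
    exact W.le_opNorm x
  rw [h1, inner_sub_left, inner_smul_left, Complex.conj_ofReal, Complex.sub_re,
    Complex.re_ofReal_mul]
  have := mul_le_mul_of_nonneg_left h3 hα
  dsimp only at h2 ⊢
  linarith

theorem IsFormSpace.denseRange_embed {E : Type*} [NormedAddCommGroup E] [InnerProductSpace ℂ E]
    {T : H →ₗ.[ℂ] H} {κ : ℝ} {ι : E →L[ℂ] H} {j : T.domain →ₗ[ℂ] E} (h : IsFormSpace T κ ι j)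
    (hT : Dense (T.domain : Set H)) : DenseRange ι :=
  hT.mono fun x hx => ⟨j ⟨x, hx⟩, h.embed _⟩

end Algebra

/-! ### The self-adjoint operator of a closed form. -/

section ShiftedInverse

variable {H : Type*} [NormedAddCommGroup H] [InnerProductSpace ℂ H] [CompleteSpace H]
variable {E : Type*} [NormedAddCommGroup E] [InnerProductSpace ℂ E] [CompleteSpace E]
variable {κ : ℝ} {ι : E →L[ℂ] H} {S : H →ₗ.[ℂ] H}

theorem isSelfAdjoint_comp_adjoint (ι : E →L[ℂ] H) : IsSelfAdjoint (ι ∘L ι.adjoint) := by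
  rw [ContinuousLinearMap.isSelfAdjoint_iff']
  simp [ContinuousLinearMap.adjoint_comp]

/-- Take `j x = ι* (S x + κ x)`; its range is that of `ι*`, dense because `ι` is injective. This
makes the form domains of the Friedrichs and Krein extensions explicit. -/
theorem IsShiftedInverse.exists_isFormSpace (h : IsShiftedInverse S κ (ι ∘L ι.adjoint))
    (hι : Function.Injective ι) : ∃ j : S.domain →ₗ[ℂ] E, IsFormSpace S κ ι j := by
  let j : S.domain →ₗ[ℂ] E :=
    ι.adjoint.toLinearMap ∘ₗ (S.toFun + (κ : ℂ) • S.domain.subtype)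
  have hj : ∀ x : S.domain, j x = ι.adjoint (S x + (κ : ℂ) • (x : H)) := fun x => rfl
  have hιj : ∀ x, ι (j x) = x := fun x => (h x (S x)).1 (S.mem_graph x)
  refine ⟨j, ?_, hιj, fun x y => ?_, hι⟩
  · refine (denseRange_adjoint hι).mono ?_
    rintro _ ⟨w, rfl⟩
    have hmem : (ι (ι.adjoint w), w - (κ : ℂ) • ι (ι.adjoint w)) ∈ S.graph :=
      (h _ _).2 (by simp)
    obtain ⟨x, hx, hy⟩ := S.mem_graph_iff.1 hmem
    refine ⟨x, ?_⟩
    rw [hj, hy, hx, sub_add_cancel]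
  · rw [hj x, ContinuousLinearMap.adjoint_inner_left, hιj, inner_add_left, inner_smul_left,
      Complex.conj_ofReal]

theorem IsShiftedInverse.dense_domain (h : IsShiftedInverse S κ (ι ∘L ι.adjoint))
    (hι : Function.Injective ι) (hd : DenseRange ι) : Dense (S.domain : Set H) := by
  obtain ⟨j, hj⟩ := h.exists_isFormSpace hι
  refine Dense.mono ?_ (hd.comp hj.dense ι.continuous)
  rintro _ ⟨x, rfl⟩
  simp [hj.embed]

/-- With `G = ι ι*`, every `G w` lies in `dom S` and `S (G w) = w - κ G w`. Testing the adjoint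
relation on these vectors gives `G (y + κ x) = x`. -/
theorem IsShiftedInverse.isSelfAdjoint (h : IsShiftedInverse S κ (ι ∘L ι.adjoint))
    (hι : Function.Injective ι) (hd : DenseRange ι) : IsSelfAdjoint S := by
  rw [isSelfAdjoint_def]
  refine LinearPMap.eq_of_eq_graph ?_
  ext ⟨x, y⟩
  rw [mem_graph_adjoint_iff (h.dense_domain hι hd), h x y]
  have hG : ∀ w v : H, inner ℂ ((ι ∘L ι.adjoint) w) v = inner ℂ w ((ι ∘L ι.adjoint) v) :=
    fun w v => by simp [← ContinuousLinearMap.adjoint_inner_left]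
  constructor
  · intro hz
    refine ext_inner_right ℂ fun w => ?_
    have hmem : ((ι ∘L ι.adjoint) w, w - (κ : ℂ) • (ι ∘L ι.adjoint) w) ∈ S.graph :=
      (h _ _).2 (by simp)
    obtain ⟨z, hz1, hz2⟩ := S.mem_graph_iff.1 hmem
    dsimp only at hz1 hz2
    have := hz z
    rw [hz1, hz2, inner_sub_right, inner_smul_right] at this
    rw [hG, inner_add_left, inner_smul_left, Complex.conj_ofReal, this]
    ring
  · intro hx z
    have hz := (h z (S z)).1 (S.mem_graph z)
    have : inner ℂ ((ι ∘L ι.adjoint) (y + (κ : ℂ) • x)) (S z + (κ : ℂ) • (z : H)) =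
        inner ℂ x (S z + (κ : ℂ) • (z : H)) := by rw [hx]
    rw [hG, hz, inner_add_left, inner_add_right, inner_smul_left, inner_smul_right,
      Complex.conj_ofReal] at this
    exact add_right_cancel this

/-- The operator of a closed form. -/
theorem exists_isShiftedInverse (κ : ℝ) (hι : Function.Injective ι) (hd : DenseRange ι) :
    ∃ S : H →ₗ.[ℂ] H, IsShiftedInverse S κ (ι ∘L ι.adjoint) := by
  let g : Submodule ℂ (H × H) :=
    LinearMap.ker ((ι ∘L ι.adjoint).toLinearMap ∘ₗ
      (LinearMap.snd ℂ H H + (κ : ℂ) • LinearMap.fst ℂ H H) - LinearMap.fst ℂ H H)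
  have hg : ∀ x y, (x, y) ∈ g ↔ (ι ∘L ι.adjoint) (y + (κ : ℂ) • x) = x := by
    intro x y
    rw [LinearMap.mem_ker, LinearMap.sub_apply, sub_eq_zero]
    rfl
  refine ⟨g.toLinearPMap, fun x y => ?_⟩
  rw [Submodule.toLinearPMap_graph_eq g, hg]
  rintro ⟨x, y⟩ hx hx0
  dsimp only at hx0 ⊢
  rw [hg, hx0, smul_zero, add_zero, ContinuousLinearMap.comp_apply] at hx
  exact injective_adjoint hd ((hι (hx.trans (_root_.map_zero ι).symm)).trans (_root_.map_zero _).symm)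

theorem isFormalAdjoint_of_isSelfAdjoint (hS : IsSelfAdjoint S) : S.IsFormalAdjoint S := by
  have := adjoint_isFormalAdjoint hS.dense_domain
  rwa [isSelfAdjoint_def.1 hS] at this

/-- Lets resolvents of semibounded self-adjoint operators be taken from the Friedrichs construction.
-/
theorem friedrichs_eq_self (hS : IsSelfAdjoint S) : friedrichs S = S := by
  refine LinearPMap.eq_of_eq_graph ?_
  ext ⟨x, y⟩
  rw [friedrichs, mem_graph_domRestrict_iff, isSelfAdjoint_def.1 hS]
  refine ⟨fun h => h.2, fun h => ⟨?_, h⟩⟩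
  obtain ⟨x', hx, -⟩ := S.mem_graph_iff.1 h
  dsimp only at hx
  exact hx ▸ mem_formDomain_of_mem_domain x'

theorem friedrichs_isSelfAdjoint {T : H →ₗ.[ℂ] H} (hT : Dense (T.domain : Set H))
    (hs : T.IsFormalAdjoint T) {c : ℝ} (hc : BoundedBelowBy T c) : IsSelfAdjoint (friedrichs T) := by
  obtain ⟨E, _, _, _, ι, j, h⟩ := exists_isFormSpace (κ := 1 - c) hs hc (by linarith)
  exact (h.friedrichs_isShiftedInverse hT).isSelfAdjoint h.injective (h.denseRange_embed hT)

theorem exists_resolvent_friedrichs {T : H →ₗ.[ℂ] H} (hT : Dense (T.domain : Set H))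
    (hs : T.IsFormalAdjoint T) {c : ℝ} (hc : BoundedBelowBy T c) {z : ℂ} (hz : z.im ≠ 0) :
    ∃ R : H →L[ℂ] H, IsResolventAt (friedrichs T) z R := by
  obtain ⟨E, _, _, _, ι, j, h⟩ := exists_isFormSpace (κ := 1 - c) hs hc (by linarith)
  exact (h.friedrichs_isShiftedInverse hT).exists_resolvent (isSelfAdjoint_comp_adjoint ι) hz

theorem subBounded_isSelfAdjoint {B : H →ₗ.[ℂ] H} (hB : IsSelfAdjoint B) (α : ℝ) {W : H →L[ℂ] H}
    (hW : W.IsPositive) : IsSelfAdjoint (subBounded B α W) := by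
  have hdom : (subBounded B α W).domain = B.domain := by
    rw [subBounded, LinearPMap.sub_domain]
    exact inf_top_eq _
  have hd : Dense ((subBounded B α W).domain : Set H) := by
    rw [hdom]
    exact hB.dense_domain
  rw [isSelfAdjoint_def]
  refine LinearPMap.eq_of_eq_graph ?_
  ext ⟨x, y⟩
  rw [mem_graph_adjoint_iff hd, mem_graph_subBounded_iff]
  conv_rhs => rw [← isSelfAdjoint_def.1 hB, mem_graph_adjoint_iff hB.dense_domain]
  have hval : ∀ z : B.domain, ∃ z' : (subBounded B α W).domain, (z' : H) = z ∧
      subBounded B α W z' = B z - (α : ℂ) • W z := by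
    intro z
    have := (mem_graph_subBounded_iff (α := α) (W := W)
      (y := B z - (α : ℂ) • W z)).2 (by rw [sub_add_cancel]; exact B.mem_graph z)
    obtain ⟨z', h1, h2⟩ := (LinearPMap.mem_graph_iff _).1 this
    exact ⟨z', h1, h2⟩
  have hsym : ∀ z : H, inner ℂ (W x) z = inner ℂ x (W z) := hW.isSymmetric x
  constructor
  · intro h z
    obtain ⟨z', h1, h2⟩ := hval z
    have := h z'
    rw [h1, h2, inner_sub_right, inner_smul_right] at this
    rw [inner_add_left, this, inner_smul_left, hsym, Complex.conj_ofReal]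
    ring
  · intro h z
    obtain ⟨z', h1, h2⟩ := hval ⟨z, hdom ▸ z.2⟩
    have : z' = z := Subtype.ext h1
    have h3 := h ⟨z, hdom ▸ z.2⟩
    rw [inner_add_left, inner_smul_left, hsym, Complex.conj_ofReal] at h3
    rw [← this, h2, inner_sub_right, inner_smul_right, ← h3, h1]
    ring

theorem exists_resolvent_subBounded {B : H →ₗ.[ℂ] H} (hB : IsSelfAdjoint B) {c : ℝ}
    (hc : BoundedBelowBy B c) {α : ℝ} (hα : 0 ≤ α) {W : H →L[ℂ] H} (hW : W.IsPositive) {z : ℂ}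
    (hz : z.im ≠ 0) : ∃ R : H →L[ℂ] H, IsResolventAt (subBounded B α W) z R := by
  have hs := subBounded_isSelfAdjoint hB α hW
  have := exists_resolvent_friedrichs hs.dense_domain (isFormalAdjoint_of_isSelfAdjoint hs)
    (subBounded_boundedBelow hc hα W) hz
  rwa [friedrichs_eq_self hs] at this

end ShiftedInverse

/-! ### Resolvents of symmetric operators: norm bounds, weak versus strong convergence. -/

section Resolvent

variable {H : Type*} [NormedAddCommGroup H] [InnerProductSpace ℂ H]
variable {T : H →ₗ.[ℂ] H} {z : ℂ} {R : H →L[ℂ] H}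

/-- The norm of `R f` in terms of the matrix element `(R f, f)`. -/
theorem IsResolventAt.im_mul_norm_sq (hT : T.IsFormalAdjoint T) (hR : IsResolventAt T z R) (f : H) :
    z.im * ‖R f‖ ^ 2 = -(inner ℂ (R f) f).im := by
  obtain ⟨x, hx, hf⟩ := hR.1 f
  rw [← hx]
  have hre : (inner ℂ (x : H) (T x)).im = 0 := by
    rw [← Complex.conj_eq_iff_im, inner_conj_symm, hT]
  have hxx : (inner ℂ (x : H) (x : H)).im = 0 := inner_self_im (𝕜 := ℂ) (x : H)
  conv_rhs => rw [← hf]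
  rw [inner_sub_right, inner_smul_right, Complex.sub_im, hre, Complex.mul_im, hxx,
    re_inner_self_real]
  ring

theorem IsResolventAt.norm_le (hT : T.IsFormalAdjoint T) (hR : IsResolventAt T z R) (f : H) :
    |z.im| * ‖R f‖ ≤ ‖f‖ := by
  have h1 : |z.im| * ‖R f‖ ^ 2 ≤ ‖R f‖ * ‖f‖ := by
    calc |z.im| * ‖R f‖ ^ 2 = |(inner ℂ (R f) f).im| := by
          rw [← abs_neg (inner ℂ (R f) f).im, ← hR.im_mul_norm_sq hT, abs_mul, abs_of_nonneg (sq_nonneg ‖R f‖)]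
      _ ≤ _ := (Complex.abs_im_le_norm _).trans (norm_inner_le_norm _ _)
  by_cases h0 : ‖R f‖ = 0
  · rw [h0, mul_zero]
    exact norm_nonneg _
  · have : 0 < ‖R f‖ := lt_of_le_of_ne (norm_nonneg _) (Ne.symm h0)
    nlinarith

/-- For resolvents of symmetric operators weak convergence implies strong convergence. -/
theorem tendsto_resolvent_of_weak {S : ℕ → H →ₗ.[ℂ] H} {Q : ℕ → H →L[ℂ] H} {l : Filter ℕ}
    (hz : z.im ≠ 0)
    (hS : ∀ n, (S n).IsFormalAdjoint (S n)) (hT : T.IsFormalAdjoint T)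
    (hQ : ∀ n, IsResolventAt (S n) z (Q n)) (hR : IsResolventAt T z R) {f : H}
    (hw : ∀ y, Tendsto (fun n => inner ℂ (Q n f) y) l (𝓝 (inner ℂ (R f) y))) :
    Tendsto (fun n => Q n f) l (𝓝 (R f)) := by
  -- Weak convergence tested against `f` itself gives convergence of the norms.
  have h1 : Tendsto (fun n => ‖Q n f‖ ^ 2) l (𝓝 (‖R f‖ ^ 2)) := by
    have := (((Complex.continuous_im.tendsto _).comp (hw f)).neg).const_mul (z.im)⁻¹
    rw [← hR.im_mul_norm_sq hT, inv_mul_cancel_left₀ hz] at this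
    refine this.congr fun n => ?_
    rw [Function.comp_apply, ← (hQ n).im_mul_norm_sq (hS n), inv_mul_cancel_left₀ hz]
  have h2 : Tendsto (fun n => ‖Q n f - R f‖ ^ 2) l (𝓝 0) := by
    have h3 := (Complex.continuous_re.tendsto _).comp (hw (R f))
    have h4 := (h1.sub (h3.const_mul 2)).add_const (‖R f‖ ^ 2)
    rw [re_inner_self_real, show ‖R f‖ ^ 2 - 2 * ‖R f‖ ^ 2 + ‖R f‖ ^ 2 = 0 by ring] at h4
    refine h4.congr fun n => ?_
    rw [@norm_sub_sq ℂ]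
    rfl
  rw [tendsto_iff_norm_sub_tendsto_zero]
  have := (Real.continuous_sqrt.tendsto 0).comp h2
  rw [Real.sqrt_zero] at this
  exact this.congr fun n => Real.sqrt_sq (norm_nonneg _)

end Resolvent

/-! ### Deficiency subspaces and the energy of an extension. -/

section Deficiency

variable {H : Type*} [NormedAddCommGroup H] [InnerProductSpace ℂ H]
variable {E : Type*} [NormedAddCommGroup E] [InnerProductSpace ℂ E]
variable {T : H →ₗ.[ℂ] H} {η : ℝ} {ι : E →L[ℂ] H} {j : T.domain →ₗ[ℂ] E}

theorem IsFormSpace.inner_shifted (hE : IsFormSpace T (-η) ι j) (x : T.domain) (e : E) :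
    inner ℂ (j x) e = inner ℂ (T x - (η : ℂ) • (x : H)) (ι e) := by
  rw [hE.inner_right, Complex.ofReal_neg, neg_smul, sub_eq_add_neg]

theorem IsFormSpace.induction_le (hE : IsFormSpace T (-η) ι j) {p q : E → ℝ} (hp : Continuous p)
    (hq : Continuous q) (h : ∀ x, p (j x) ≤ q (j x)) (e : E) : p e ≤ q e :=
  hE.dense.induction_on (p := fun e => p e ≤ q e) e (isClosed_le hp hq) h

theorem IsFormSpace.norm_embed_sq_le (hE : IsFormSpace T (-η) ι j) (h0 : BoundedBelowBy T 0)
    (e : E) : -η * ‖ι e‖ ^ 2 ≤ ‖e‖ ^ 2 := by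
  refine hE.induction_le (p := fun e => -η * ‖ι e‖ ^ 2) (q := fun e => ‖e‖ ^ 2) (by fun_prop)
    (by fun_prop) (fun x => ?_) e
  rw [hE.norm_sq, hE.embed]
  linarith [h0 x]

variable [CompleteSpace H]

/-- Orthogonality to the range of `T - η` is the form in which membership passes to strong and weak
limits. -/
theorem mem_deficiencySpace_iff (hT : Dense (T.domain : Set H)) {h : H} :
    h ∈ deficiencySpace T η ↔ ∀ x : T.domain, inner ℂ (T x - (η : ℂ) • (x : H)) h = 0 := by
  have : h ∈ deficiencySpace T η ↔ (h, (η : ℂ) • h) ∈ T†.graph := Iff.rfl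
  rw [this, mem_graph_adjoint_iff hT]
  refine forall_congr' fun x => ?_
  rw [inner_smul_left, inner_sub_left, inner_smul_left, sub_eq_zero, Complex.conj_ofReal,
    ← inner_conj_symm h (T x), ← inner_conj_symm h (x : H), ← (starRingEnd ℂ).injective.eq_iff]
  simp only [map_mul, Complex.conj_conj, Complex.conj_ofReal]
  exact eq_comm

theorem isClosed_deficiencySpace (hT : Dense (T.domain : Set H)) :
    IsClosed (deficiencySpace T η : Set H) := by
  have : (deficiencySpace T η : Set H) =
      ⋂ x : T.domain, {h | inner ℂ (T x - (η : ℂ) • (x : H)) h = 0} := by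
    ext h
    simp only [SetLike.mem_coe, Set.mem_iInter, Set.mem_ofPred_eq]
    exact mem_deficiencySpace_iff hT
  rw [this]
  exact isClosed_iInter fun x => isClosed_eq (by fun_prop) continuous_const

theorem mem_deficiencySpace_of_weak_limit (hT : Dense (T.domain : Set H)) {l : Filter ℕ} [l.NeBot]
    {u : ℕ → H} {h : H} (hu : ∀ n, u n ∈ deficiencySpace T η)
    (hw : ∀ y, Tendsto (fun n => inner ℂ (u n) y) l (𝓝 (inner ℂ h y))) :
    h ∈ deficiencySpace T η := by
  rw [mem_deficiencySpace_iff hT]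
  intro x
  have h1 := hw (T x - (η : ℂ) • (x : H))
  have h2 : ∀ n, inner ℂ (u n) (T x - (η : ℂ) • (x : H)) = 0 := fun n => by
    rw [← inner_conj_symm, (mem_deficiencySpace_iff hT).1 (hu n) x, _root_.map_zero]
  simp only [h2] at h1
  rw [← inner_conj_symm, ← tendsto_nhds_unique tendsto_const_nhds h1, _root_.map_zero]

/-- `(j x, e) = ((T - η) x, ι e) = 0` for all `x`, and `j` has dense range. -/
theorem IsFormSpace.eq_zero_of_mem_deficiencySpace (hT : Dense (T.domain : Set H))
    (hE : IsFormSpace T (-η) ι j) {e : E} (he : ι e ∈ deficiencySpace T η) : e = 0 := by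
  rw [mem_deficiencySpace_iff hT] at he
  have h0 : (fun y => inner ℂ y e) = fun _ => (0 : ℂ) :=
    hE.dense.equalizer (by fun_prop) (by fun_prop) (funext fun x => by
      simp only [Function.comp_apply, hE.inner_shifted, he])
  exact inner_self_eq_zero.1 (congrFun h0 e)

variable [CompleteSpace E]

/-- The Friedrichs extension has the same form space. -/
theorem IsFormSpace.exists_friedrichs {κ : ℝ} (hE : IsFormSpace T κ ι j)
    (hT : Dense (T.domain : Set H)) :
    ∃ j' : (friedrichs T).domain →ₗ[ℂ] E, IsFormSpace (friedrichs T) κ ι j' :=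
  (hE.friedrichs_isShiftedInverse hT).exists_isFormSpace hE.injective

/-- Energy of the elements of `dom B` in terms of the decomposition of the form domain. -/
theorem CorrespondsTo.exists_decomposition {B : H →ₗ.[ℂ] H} {q : NonnegForm H}
    (hT : Dense (T.domain : Set H)) (hE : IsFormSpace T (-η) ι j)
    (hB : IsSelfAdjointExtension T η B) (hq : CorrespondsTo T η B q)
    (hcl : IsClosed (q.domain : Set H)) :
    ∃ Q : ℝ, 0 ≤ Q ∧ ∀ u : B.domain, ∃ (g : E) (h : H) (s : ℝ), h ∈ deficiencySpace T η ∧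
      (u : H) = ι g + h ∧ s ≤ Q * ‖h‖ ^ 2 ∧
      (inner ℂ (B u) (u : H)).re = ‖g‖ ^ 2 + s + η * ‖(u : H)‖ ^ 2 ∧
      (inner ℂ (B u) (ι g)).re = ‖g‖ ^ 2 + η * (inner ℂ (u : H) (ι g)).re := by
  obtain ⟨F, _, _, _, ιB, jB, hF⟩ := exists_isFormSpace (κ := 1 - η)
    (isFormalAdjoint_of_isSelfAdjoint hB.selfAdjoint) hB.bound (by linarith)
  obtain ⟨j', hE'⟩ := hE.exists_friedrichs hT
  -- `F` carries the shift `1 - η`, so the `η`-terms of the form value combine and only `‖ι g + h‖²`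
  -- remains.
  have lift : ∀ (g : E) (h : q.domain), ∃ e : F, ιB e = ι g + h ∧
      ‖e‖ ^ 2 = ‖g‖ ^ 2 + (q.form h h).re + ‖ι g + h‖ ^ 2 := by
    intro g h
    have h1 := hq.value (ι g) _ (hE'.hasFormValue_iff.2 ⟨g, rfl, rfl⟩) h
    obtain ⟨e, he, hr⟩ := hF.hasFormValue_iff.1 h1
    refine ⟨e, he, ?_⟩
    have h2 := @norm_add_sq ℂ _ _ _ _ (ι g) (h : H)
    simp only [RCLike.re_to_complex] at h2
    linear_combination -hr - η * h2
  choose Φ hΦ hΦn using lift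
  have Φ_add : ∀ g g' h h', Φ g h + Φ g' h' = Φ (g + g') (h + h') := by
    intro g g' h h'
    apply hF.injective
    rw [_root_.map_add, hΦ, hΦ, hΦ, _root_.map_add, Submodule.coe_add]
    abel
  obtain ⟨Q, hQ0, hQ⟩ : ∃ Q : ℝ, 0 ≤ Q ∧ ∀ h : q.domain, (q.form h h).re ≤ Q * ‖(h : H)‖ ^ 2 := by
    let Ψ : q.domain →ₗ[ℂ] F :=
      { toFun := fun h => Φ 0 h
        map_add' := fun h h' => by rw [Φ_add, add_zero]
        map_smul' := fun r h => hF.injective (by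
          simp only [hΦ, _root_.map_smul, _root_.map_zero, zero_add, RingHom.id_apply,
            Submodule.coe_smul]) }
    have : CompleteSpace q.domain := hcl.completeSpace_coe
    -- Closed graph theorem: `dom q` is complete, and a limit in `F` is determined by its image
    -- under the injective `ιB`.
    have hΨ : Continuous Ψ := by
      refine Ψ.continuous_of_seq_closed_graph fun u x y hu hy => ?_
      apply hF.injective
      have h1 : Tendsto (fun n => ιB (Ψ (u n))) atTop (𝓝 (ιB y)) :=
        (ιB.continuous.tendsto y).comp hy
      have h2 : ∀ h, ιB (Ψ h) = h := fun h => (hΦ 0 h).trans (by simp)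
      simp only [h2] at h1 ⊢
      exact tendsto_nhds_unique h1 ((continuous_subtype_val.tendsto x).comp hu)
    let Ψ' : q.domain →L[ℂ] F := ⟨Ψ, hΨ⟩
    refine ⟨‖Ψ'‖ ^ 2, sq_nonneg _, fun h => ?_⟩
    have h1 : ‖Φ 0 h‖ ≤ ‖Ψ'‖ * ‖(h : H)‖ := Ψ'.le_opNorm h
    have h2 := hΦn 0 h
    have h3 : ‖Φ 0 h‖ ^ 2 ≤ (‖Ψ'‖ * ‖(h : H)‖) ^ 2 := by gcongr
    rw [mul_pow] at h3
    have h4 : (0 : ℝ) ≤ ‖(0 : E)‖ ^ 2 := sq_nonneg _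
    have h5 : (0 : ℝ) ≤ ‖ι (0 : E) + (h : H)‖ ^ 2 := sq_nonneg _
    linarith
  refine ⟨Q, hQ0, fun u => ?_⟩
  have hu : (u : H) ∈ formDomain (friedrichs T) ⊔ q.domain :=
    hq.formDomain_eq ▸ mem_formDomain_of_mem_domain u
  obtain ⟨x, hx, h, hh, hxh⟩ := Submodule.mem_sup.1 hu
  obtain ⟨g, rfl⟩ := hE'.mem_formDomain_iff.1 hx
  set h' : q.domain := ⟨h, hh⟩
  have hjB : jB u = Φ g h' := hF.injective (by rw [hF.embed, hΦ, ← hxh])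
  have hn := hF.norm_sq u
  rw [hjB, hΦn, show ι g + (h' : H) = u from hxh] at hn
  refine ⟨g, h, (q.form h' h').re, hq.domain_le hh, hxh.symm, hQ h', by linarith, ?_⟩
  -- Polarization: expanding `‖Φ g h' + Φ g 0‖² = ‖Φ (2 g) h'‖²` shows that `q` contributes nothing
  -- to the pairing with `ι g`.
  have hc := congrArg Complex.re (hF.inner_right u (Φ g 0))
  rw [hjB, hΦ, ZeroMemClass.coe_zero, add_zero, inner_add_left, inner_smul_left,
    Complex.conj_ofReal, Complex.add_re, Complex.re_ofReal_mul] at hc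
  have hsq := @norm_add_sq ℂ _ _ _ _ (Φ g h') (Φ g 0)
  have h1 := hΦn (g + g) (h' + 0)
  have h2 := hΦn g h'
  have h3 := hΦn g 0
  rw [Φ_add, h1, h2, h3, add_zero, ← two_smul ℂ g, _root_.map_smul, norm_smul] at hsq
  have h4 := @norm_add_sq ℂ _ _ _ _ (u : H) (ι g)
  rw [show (2 : ℂ) • ι g + (h' : H) = (u : H) + ι g by rw [← hxh, two_smul]; abel,
    show ι g + (h' : H) = u from hxh, h4] at hsq
  simp only [RCLike.re_to_complex, RCLike.norm_ofNat, ZeroMemClass.coe_zero, add_zero,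
    _root_.map_zero, Complex.zero_re] at hsq
  linarith

end Deficiency

/-! ### Construction of the Krein extension. -/

section Krein

variable {H : Type*} [NormedAddCommGroup H] [InnerProductSpace ℂ H]

theorem zeroOn_form_apply {N : Submodule ℂ H} (x y : (NonnegForm.zeroOn N).domain) :
    (NonnegForm.zeroOn N).form x y = 0 :=
  rfl

variable [CompleteSpace H]

/-- On pairs `(g, x)` with `x - ι g ∈ N_η`, the norm `‖g‖² + ‖x‖²` with shift `1 - η` yields the
form `‖g‖² + η ‖x‖²`: it is at least `η ‖x‖²`, and the component in `N_η` carries no extra energy.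
-/
theorem exists_isKreinExtension {T : H →ₗ.[ℂ] H} (hT : Dense (T.domain : Set H))
    (hs : T.IsFormalAdjoint T) (h0 : BoundedBelowBy T 0) {η : ℝ} (hη : η < 0) :
    ∃ K : H →ₗ.[ℂ] H, IsKreinExtension T η K := by
  obtain ⟨E, _, _, _, ι, j, hE⟩ := exists_isFormSpace (κ := -η) hs h0 (by linarith)
  obtain ⟨j', hE'⟩ := hE.exists_friedrichs hT
  let P : WithLp 2 (E × H) →L[ℂ] H :=
    (ContinuousLinearMap.snd ℂ E H) ∘L (WithLp.prodContinuousLinearEquiv 2 ℂ E H).toContinuousLinearMap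
  let P' : WithLp 2 (E × H) →L[ℂ] E :=
    (ContinuousLinearMap.fst ℂ E H) ∘L (WithLp.prodContinuousLinearEquiv 2 ℂ E H).toContinuousLinearMap
  let F : Submodule ℂ (WithLp 2 (E × H)) :=
    (deficiencySpace T η).comap (P - ι ∘L P').toLinearMap
  have hFmem : ∀ v : WithLp 2 (E × H), v ∈ F ↔ v.snd - ι v.fst ∈ deficiencySpace T η :=
    fun v => Iff.rfl
  have hFc : IsClosed (F : Set (WithLp 2 (E × H))) :=
    (isClosed_deficiencySpace hT).preimage (P - ι ∘L P').continuous
  have : CompleteSpace F := hFc.completeSpace_coe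
  let ιF : F →L[ℂ] H := P ∘L F.subtypeL
  have hιF : ∀ v : F, ιF v = (v : WithLp 2 (E × H)).snd := fun v => rfl
  have hinj : Function.Injective ιF := by
    rw [injective_iff_map_eq_zero]
    rintro ⟨v, hv⟩ hv0
    have h1 : v.snd = 0 := hv0
    have h2 : v.fst = 0 := by
      rw [hFmem, h1, zero_sub] at hv
      exact hE.eq_zero_of_mem_deficiencySpace hT (neg_mem_iff.1 hv)
    refine Subtype.ext ?_
    exact (WithLp.prodContinuousLinearEquiv 2 ℂ E H).injective (Prod.ext h2 h1)
  let emb : ∀ (g : E) (h : H), h ∈ deficiencySpace T η → F := fun g h hh =>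
    ⟨WithLp.toLp 2 (g, ι g + h), by
      rw [hFmem]
      simpa using hh⟩
  have hdense : DenseRange ιF := by
    refine (hE.denseRange_embed hT).mono ?_
    rintro _ ⟨g, rfl⟩
    exact ⟨emb g 0 (zero_mem _), by simp [hιF, emb]⟩
  obtain ⟨K, hK⟩ := exists_isShiftedInverse (1 - η) hinj hdense
  obtain ⟨jK, hF⟩ := hK.exists_isFormSpace hinj
  have hnorm : ∀ v : F, ‖v‖ ^ 2 =
      ‖(v : WithLp 2 (E × H)).fst‖ ^ 2 + ‖(v : WithLp 2 (E × H)).snd‖ ^ 2 := fun v =>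
    WithLp.prod_norm_sq_eq_of_L2 (v : WithLp 2 (E × H))
  refine ⟨K, ⟨hK.isSelfAdjoint hinj hdense, ?_, fun x => ?_⟩, ⟨le_rfl, ?_, ?_, ?_, ?_⟩⟩
  · refine LinearPMap.le_of_le_graph ?_
    rintro ⟨x, y⟩ hxy
    obtain ⟨x', hx, hy⟩ := T.mem_graph_iff.1 hxy
    dsimp only at hx hy
    subst hx hy
    rw [hK]
    -- For `v ∈ F`, `T x' - η x'` is orthogonal to `v.snd - ι v.fst`, so its pairing with `v.snd` is
    -- the `E`-product of `j x'` with `v.fst`. Hence `K` extends `T`.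
    have : ιF.adjoint (T x' + ((1 - η : ℝ) : ℂ) • (x' : H)) = emb (j x') 0 (zero_mem _) := by
      refine ext_inner_right ℂ fun v => ?_
      rw [ContinuousLinearMap.adjoint_inner_left, hιF, Submodule.coe_inner,
        WithLp.prod_inner_apply]
      have h1 := (mem_deficiencySpace_iff hT).1 ((hFmem _).1 v.2) x'
      rw [inner_sub_right, sub_eq_zero, ← hE.inner_shifted] at h1
      simp only [emb, WithLp.ofLp_fst, WithLp.ofLp_snd, hE.embed, add_zero] at h1 ⊢
      rw [← h1, ← inner_add_left]
      congr 1
      push_cast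
      module
    rw [ContinuousLinearMap.comp_apply, this, hιF]
    simp [emb, hE.embed]
  · have h1 := hF.norm_sq x
    rw [hnorm, ← hιF, hF.embed] at h1
    nlinarith [sq_nonneg ‖((jK x : F) : WithLp 2 (E × H)).fst‖]
  · intro u f hu _
    have hf : f ∈ deficiencySpace T η :=
      (isClosed_deficiencySpace hT).mem_of_tendsto hu (Eventually.of_forall fun n => (u n).2)
    exact ⟨hf, tendsto_const_nhds.congr fun n => congrArg Complex.re (zeroOn_form_apply _ _).symm⟩
  · rw [Submodule.disjoint_def]
    intro x hx hx'
    obtain ⟨g, rfl⟩ := hE'.mem_formDomain_iff.1 hx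
    rw [hE.eq_zero_of_mem_deficiencySpace hT hx', _root_.map_zero]
  · ext x
    rw [hF.mem_formDomain_iff, Submodule.mem_sup]
    constructor
    · rintro ⟨v, rfl⟩
      exact ⟨ι (v : WithLp 2 (E × H)).fst, hE'.mem_formDomain_iff.2 ⟨_, rfl⟩, _, (hFmem _).1 v.2,
        by rw [hιF]; abel⟩
    · rintro ⟨y, hy, h, hh, rfl⟩
      obtain ⟨g, rfl⟩ := hE'.mem_formDomain_iff.1 hy
      exact ⟨emb g h hh, rfl⟩
  · rintro x r hr ⟨h, hh⟩
    obtain ⟨g, rfl, rfl⟩ := hE'.hasFormValue_iff.1 hr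
    refine hF.hasFormValue_iff.2 ⟨emb g h hh, rfl, ?_⟩
    have h2 := @norm_add_sq ℂ _ _ _ _ (ι g) h
    have h3 : ‖emb g h hh‖ ^ 2 = ‖g‖ ^ 2 + ‖ι g + h‖ ^ 2 := hnorm _
    simp only [RCLike.re_to_complex] at h2
    rw [h3, zeroOn_form_apply, Complex.zero_re]
    linear_combination -η * h2

end Krein

/-! ### A priori estimates and the use of admissibility. -/

section Estimates

variable {H : Type*} [NormedAddCommGroup H] [InnerProductSpace ℂ H]

theorem _root_.ContinuousLinearMap.IsPositive.re_inner_add_le {W : H →L[ℂ] H} (hW : W.IsPositive) (x y : H) :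
    (inner ℂ (W (x + y)) (x + y)).re ≤
      2 * (inner ℂ (W x) x).re + 2 * (inner ℂ (W y) y).re := by
  have h : 0 ≤ (inner ℂ (W (x - y)) (x - y)).re := hW.re_inner_nonneg_left _
  simp only [_root_.map_add, _root_.map_sub, inner_add_left, inner_add_right, inner_sub_left,
    inner_sub_right, Complex.add_re, Complex.sub_re] at h ⊢
  linarith

variable {E : Type*} [NormedAddCommGroup E] [InnerProductSpace ℂ E] {η : ℝ} {ι : E →L[ℂ] H}

/-- The absorption argument, with `X = ‖g‖`, `Y = ‖ι g‖`, `N = ‖h‖`, `ω = (W u, u)` and `r = Re (W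
u, ι g)`. Three terms of size `X² / 4` are absorbed on the left of `e2`: from `c₂ Y`, from the
arithmetic-geometric bound on `α r`, and from the smallness of `α`. This leaves the factor `4`; `1 +
2 Q / δ` is the coefficient of `X²` once `s` is estimated. -/
theorem bounds_of_energy_estimates {α a' Q δ M c₁ c₂ X Y N s ω r : ℝ} (hα : 0 < α) (ha' : 0 < a')
    (hQ : 0 ≤ Q) (hδ : 0 < δ) (hsmall : α * a' * (1 + 2 * (Q / δ)) ≤ 1 / 4) (hω : 0 ≤ ω)
    (hN : 0 ≤ N) (e1 : α * ω ≤ X ^ 2 + s + c₁) (e2 : X ^ 2 ≤ c₂ * Y + α * r)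
    (hr : r ^ 2 ≤ ω * (a' * X ^ 2)) (hY : δ * Y ^ 2 ≤ X ^ 2) (hNY : N ≤ M + Y)
    (hs : s ≤ Q * N ^ 2) :
    X ^ 2 ≤ 4 * (c₂ ^ 2 / δ + α * a' * (c₁ + Q * (2 * M ^ 2))) ∧
      N ^ 2 ≤ 2 * M ^ 2 + 2 * (X ^ 2 / δ) ∧ ω ≤ (X ^ 2 + Q * N ^ 2 + c₁) / α := by
  have e3 : α * r ≤ X ^ 2 / 4 + α * a' * (α * ω) := by
    have ht : 0 ≤ α * a' * (α * ω) := by positivity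
    refine le_of_abs_le (abs_le_of_sq_le_sq ?_ (by positivity))
    have h5 : (α * r) ^ 2 ≤ X ^ 2 * (α * a' * (α * ω)) := by
      calc (α * r) ^ 2 = α ^ 2 * r ^ 2 := by ring
        _ ≤ α ^ 2 * (ω * (a' * X ^ 2)) := by gcongr
        _ = _ := by ring
    nlinarith [sq_nonneg (X ^ 2 / 4 - α * a' * (α * ω))]
  have e4 : c₂ * Y ≤ X ^ 2 / 4 + c₂ ^ 2 / δ := by
    have h6 : δ * Y ^ 2 / 4 + c₂ ^ 2 / δ - c₂ * Y = (δ * Y / 2 - c₂) ^ 2 / δ := by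
      field_simp
      ring
    have : 0 ≤ (δ * Y / 2 - c₂) ^ 2 / δ := by positivity
    linarith
  have hιg : Y ^ 2 ≤ X ^ 2 / δ := by
    rw [le_div_iff₀ hδ]
    linarith
  have e5 : N ^ 2 ≤ 2 * M ^ 2 + 2 * (X ^ 2 / δ) := by
    have h8 : N ^ 2 ≤ (M + Y) ^ 2 := by gcongr
    linarith [sq_nonneg (M - Y)]
  have e6 : s ≤ Q * (2 * M ^ 2) + 2 * (Q / δ) * X ^ 2 := by
    refine hs.trans ((mul_le_mul_of_nonneg_left e5 hQ).trans (le_of_eq ?_))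
    ring
  have e7 : α * a' * (α * ω) ≤ X ^ 2 / 4 + α * a' * (c₁ + Q * (2 * M ^ 2)) := by
    have hp : 0 ≤ α * a' := by positivity
    calc α * a' * (α * ω) ≤ α * a' * (X ^ 2 + (Q * (2 * M ^ 2) + 2 * (Q / δ) * X ^ 2) + c₁) :=
          mul_le_mul_of_nonneg_left (by linarith) hp
      _ = α * a' * (1 + 2 * (Q / δ)) * X ^ 2 + α * a' * (c₁ + Q * (2 * M ^ 2)) := by ring
      _ ≤ 1 / 4 * X ^ 2 + α * a' * (c₁ + Q * (2 * M ^ 2)) := by gcongr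
      _ = _ := by ring
  refine ⟨by linarith, e5, ?_⟩
  rw [le_div_iff₀ hα, mul_comm]
  linarith

/-- An a priori bound for the solutions of `(B - α W - z) u = f`, uniform in `W`. -/
theorem exists_a_priori_bound (hη : η < 0) (hle : ∀ e, -η * ‖ι e‖ ^ 2 ≤ ‖e‖ ^ 2)
    {Q a' α : ℝ} (hQ : 0 ≤ Q) (hα : 0 < α)
    (ha' : 0 < a') (hsmall : α * a' * (1 + 2 * (Q / -η)) ≤ 1 / 4) (z : ℂ) (f : H) (M : ℝ) :
    ∃ C, 0 ≤ C ∧ ∀ (W : H →L[ℂ] H) (u w h : H) (g : E) (s : ℝ), W.IsPositive →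
      (∀ e, (inner ℂ (W (ι e)) (ι e)).re ≤ a' * ‖e‖ ^ 2) →
      u = ι g + h → s ≤ Q * ‖h‖ ^ 2 →
      (inner ℂ w u).re = ‖g‖ ^ 2 + s + η * ‖u‖ ^ 2 →
      (inner ℂ w (ι g)).re = ‖g‖ ^ 2 + η * (inner ℂ u (ι g)).re →
      w = f + (α : ℂ) • W u + z • u → ‖u‖ ≤ M →
      ‖g‖ ^ 2 ≤ C ∧ ‖h‖ ^ 2 ≤ C ∧ (inner ℂ (W u) u).re ≤ C := by
  set δ := -η with hδ
  have hδ0 : 0 < δ := by linarith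
  -- `c₁` collects the lower-order terms of the equation tested against `u`, and `c₂ ‖ι g‖` those of
  -- the equation tested against `ι g`.
  set c₁ := ‖f‖ * M + ‖z‖ * M ^ 2 with hc₁
  set c₂ := ‖f‖ + δ * M + ‖z‖ * M with hc₂
  set C₀ := 4 * (c₂ ^ 2 / δ + α * a' * (c₁ + Q * (2 * M ^ 2))) with hC₀
  set C₁ := 2 * M ^ 2 + 2 * (C₀ / δ) with hC₁
  set C₂ := (C₀ + Q * C₁ + c₁) / α with hC₂
  refine ⟨max 0 (max C₀ (max C₁ C₂)), le_max_left _ _, ?_⟩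
  intro W u w h g s hW hWb hu hs h1 h2 hw hM
  have hu0 := norm_nonneg u
  have hM0 : 0 ≤ M := hu0.trans hM
  have hwu : (inner ℂ w u).re = (inner ℂ f u).re + α * (inner ℂ (W u) u).re +
      z.re * ‖u‖ ^ 2 := by
    have hxx : (inner ℂ u u).im = 0 := inner_self_im (𝕜 := ℂ) u
    rw [hw, inner_add_left, inner_add_left, inner_smul_left, inner_smul_left, Complex.conj_ofReal,
      Complex.add_re, Complex.add_re, Complex.re_ofReal_mul, Complex.mul_re, hxx,
      re_inner_self_real, Complex.conj_re]
    ring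
  have hwg : (inner ℂ w (ι g)).re = (inner ℂ f (ι g)).re + α * (inner ℂ (W u) (ι g)).re +
      (conj z * inner ℂ u (ι g)).re := by
    rw [hw, inner_add_left, inner_add_left, inner_smul_left, inner_smul_left, Complex.conj_ofReal,
      Complex.add_re, Complex.add_re, Complex.re_ofReal_mul]
  set ω := (inner ℂ (W u) u).re with hω
  set r := (inner ℂ (W u) (ι g)).re with hr
  have hω0 : 0 ≤ ω := hW.re_inner_nonneg_left u
  have hfu : |(inner ℂ f u).re| ≤ ‖f‖ * M :=
    (Complex.abs_re_le_norm _).trans ((norm_inner_le_norm _ _).trans (by gcongr))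
  have hzu : |z.re * ‖u‖ ^ 2| ≤ ‖z‖ * M ^ 2 := by
    rw [abs_mul, abs_of_nonneg (sq_nonneg ‖u‖)]
    gcongr
    exact Complex.abs_re_le_norm z
  have e1 : α * ω ≤ ‖g‖ ^ 2 + s + c₁ := by
    have := abs_le.1 hfu
    have := abs_le.1 hzu
    have : η * ‖u‖ ^ 2 ≤ 0 := mul_nonpos_of_nonpos_of_nonneg hη.le (sq_nonneg _)
    linarith
  have hfg : |(inner ℂ f (ι g)).re| ≤ ‖f‖ * ‖ι g‖ :=
    (Complex.abs_re_le_norm _).trans (norm_inner_le_norm _ _)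
  have hug : ‖inner ℂ u (ι g)‖ ≤ M * ‖ι g‖ := (norm_inner_le_norm _ _).trans (by gcongr)
  have hzg : |(conj z * inner ℂ u (ι g)).re| ≤ ‖z‖ * (M * ‖ι g‖) := by
    refine (Complex.abs_re_le_norm _).trans ?_
    rw [norm_mul, RCLike.norm_conj]
    gcongr
  have hηg : |δ * (inner ℂ u (ι g)).re| ≤ δ * (M * ‖ι g‖) := by
    rw [abs_mul, abs_of_pos hδ0]
    gcongr
    exact (Complex.abs_re_le_norm _).trans hug
  have e2 : ‖g‖ ^ 2 ≤ c₂ * ‖ι g‖ + α * r := by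
    have := abs_le.1 hfg
    have := abs_le.1 hzg
    have := abs_le.1 hηg
    rw [hc₂]
    linarith
  have hr2 : r ^ 2 ≤ ω * (a' * ‖g‖ ^ 2) := by
    have h3 := hW.norm_inner_sq_le u (ι g)
    have h4 : r ^ 2 ≤ ‖inner ℂ (W u) (ι g)‖ ^ 2 := by
      rw [← sq_abs r]
      gcongr
      exact Complex.abs_re_le_norm _
    exact h4.trans (h3.trans (mul_le_mul_of_nonneg_left (hWb g) hω0))
  have hN : ‖h‖ ≤ M + ‖ι g‖ := by
    have : h = u - ι g := by rw [hu]; abel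
    rw [this]
    exact (norm_sub_le _ _).trans (by gcongr)
  obtain ⟨f0, f1, f2⟩ := bounds_of_energy_estimates hα ha' hQ hδ0 hsmall hω0 (norm_nonneg h) e1 e2
    hr2 (hle g) hN hs
  have f1' : ‖h‖ ^ 2 ≤ C₁ := f1.trans (by rw [hC₁]; gcongr)
  have f2' : ω ≤ C₂ := f2.trans (by rw [hC₂]; gcongr)
  simp only [le_max_iff]
  exact ⟨.inr (.inl f0), .inr (.inr (.inl f1')), .inr (.inr (.inr f2'))⟩

variable [CompleteSpace H] [CompleteSpace E] {T : H →ₗ.[ℂ] H} {j : T.domain →ₗ[ℂ] E}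

/-- Admissibility does not depend on the choice of the spectral parameter. -/
theorem IsAdmissible.eq_zero (hT : Dense (T.domain : Set H)) (hs : T.IsFormalAdjoint T)
    (h0 : BoundedBelowBy T 0) (hE : IsFormSpace T (-η) ι j) {Vn : ℕ → H →L[ℂ] H}
    (hpos : ∀ n, (Vn n).IsPositive) {a' : ℝ}
    (hbd : ∀ n e, (inner ℂ (Vn n (ι e)) (ι e)).re ≤ a' * ‖e‖ ^ 2)
    (hadm : IsAdmissible T Vn) {h : H} (hh : h ∈ deficiencySpace T η) {C : ℝ}
    (hC : ∀ n, (inner ℂ (Vn n h) h).re ≤ C) : h = 0 := by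
  obtain ⟨η₀, hη₀, hadm⟩ := hadm
  obtain ⟨E₀, _, _, _, ι₀, j₀, hE₀⟩ := exists_isFormSpace (κ := -η₀) hs h0 (by linarith)
  -- `ι₀ ι₀*` inverts the Friedrichs extension minus `η₀`; adding this correction moves `h` from
  -- `N_η` to `N_η₀`, and `k` lies in the common form domain, where the `V_n` are uniformly bounded.
  set k : H := ι₀ (ι₀.adjoint (((η₀ - η : ℝ) : ℂ) • h)) with hk
  obtain ⟨e, he⟩ : ∃ e, ι e = k := hE.mem_formDomain_iff.1 (hE₀.mem_formDomain_iff.2 ⟨_, rfl⟩)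
  have hmem : h + k ∈ deficiencySpace T η₀ := by
    rw [mem_deficiencySpace_iff hT] at hh ⊢
    intro x
    have h1 := hh x
    have h2 := hE₀.inner_shifted x (ι₀.adjoint (((η₀ - η : ℝ) : ℂ) • h))
    rw [ContinuousLinearMap.adjoint_inner_right, hE₀.embed, ← hk, inner_smul_right] at h2
    rw [inner_add_right, ← h2, inner_sub_left, inner_smul_left, Complex.conj_ofReal]
    rw [inner_sub_left, inner_smul_left, Complex.conj_ofReal] at h1
    push_cast
    linear_combination h1
  have hz : h + k = 0 := by
    by_contra hne
    refine hadm _ hmem hne ⟨2 * C + 2 * (a' * ‖e‖ ^ 2), ?_⟩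
    rintro _ ⟨n, rfl⟩
    refine ((hpos n).re_inner_add_le h k).trans ?_
    have := hbd n e
    rw [he] at this
    linarith [hC n]
  -- So `h` lies in both `N_η` and the form domain, which meet only in `0`.
  have hhe : h = ι (-e) := by
    rw [_root_.map_neg, he]
    exact eq_neg_of_add_eq_zero_left hz
  rw [hhe] at hh ⊢
  rw [hE.eq_zero_of_mem_deficiencySpace hT hh, _root_.map_zero]

end Estimates

section Perturbation

variable {H : Type*} [NormedAddCommGroup H] [InnerProductSpace ℂ H]

/-! ### The singular operators `A - α V` on `D`. -/

section Operators

variable {A V : H →ₗ.[ℂ] H} {D : Submodule ℂ H}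

theorem domRestrict_domain_eq (hDA : D ≤ A.domain) : (A.domRestrict D).domain = D := by
  rw [domRestrict_domain]
  exact inf_eq_left.2 hDA

theorem domRestrict_isFormalAdjoint (hA : A.IsFormalAdjoint A) :
    (A.domRestrict D).IsFormalAdjoint (A.domRestrict D) :=
  fun x y => hA ⟨x, x.2.2⟩ ⟨y, y.2.2⟩

theorem domRestrict_boundedBelow {c : ℝ} (hA : BoundedBelowBy A c) :
    BoundedBelowBy (A.domRestrict D) c :=
  fun x => hA ⟨x, x.2.2⟩

theorem singularOp_domain_eq (hDA : D ≤ A.domain) (hDV : D ≤ V.domain) (α : ℝ) :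
    (singularOp A V D α).domain = D := by
  rw [singularOp]
  exact domRestrict_domain_eq (le_inf hDA hDV)

theorem singularOp_apply (α : ℝ) (x : (singularOp A V D α).domain) :
    singularOp A V D α x =
      A ⟨x, x.2.2.1⟩ - (α : ℂ) • V ⟨x, x.2.2.2⟩ :=
  rfl

theorem singularOp_isFormalAdjoint (hA : A.IsFormalAdjoint A) (hV : V.IsFormalAdjoint V) (α : ℝ) :
    (singularOp A V D α).IsFormalAdjoint (singularOp A V D α) := by
  intro x y
  rw [singularOp_apply, singularOp_apply, inner_sub_left, inner_sub_right, inner_smul_left,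
    inner_smul_right, Complex.conj_ofReal]
  have h1 := hA ⟨x, x.2.2.1⟩ ⟨y, y.2.2.1⟩
  have h2 := hV ⟨x, x.2.2.2⟩ ⟨y, y.2.2.2⟩
  dsimp only at h1 h2
  rw [h1, h2]

theorem re_inner_singularOp (α : ℝ) (x : (singularOp A V D α).domain) :
    (inner ℂ (singularOp A V D α x) (x : H)).re =
      (inner ℂ (A ⟨x, x.2.2.1⟩) (x : H)).re - α * (inner ℂ (V ⟨x, x.2.2.2⟩) (x : H)).re := by
  rw [singularOp_apply, inner_sub_left, inner_smul_left, Complex.conj_ofReal, Complex.sub_re,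
    Complex.re_ofReal_mul]

theorem singularOp_boundedBelow {hDA : D ≤ A.domain} {hDV : D ≤ V.domain}
    (hA : BoundedBelowBy A 0) {a b α : ℝ} (hα : 0 ≤ α)
    (haα : α * a ≤ 1)
    (hVA : ∀ (f : H) (hf : f ∈ D),
      (inner ℂ (V ⟨f, hDV hf⟩) f).re ≤ a * (inner ℂ (A ⟨f, hDA hf⟩) f).re + b * ‖f‖ ^ 2) :
    BoundedBelowBy (singularOp A V D α) (-(α * b)) := by
  intro x
  rw [re_inner_singularOp]
  have h1 := mul_le_mul_of_nonneg_left (hVA x x.2.1) hα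
  have h2 := hA ⟨x, x.2.2.1⟩
  dsimp only at h1 h2
  rw [zero_mul] at h2
  have h3 := mul_le_mul_of_nonneg_right haα h2
  linarith

end Operators

/-! ### Limits of the regularized potentials. -/

section Convergence

variable {E : Type*} [NormedAddCommGroup E] [InnerProductSpace ℂ E]
variable {A V : H →ₗ.[ℂ] H} {D : Submodule ℂ H} {a b η : ℝ} {ι : E →L[ℂ] H}
  {j : (A.domRestrict D).domain →ₗ[ℂ] E} {Vn : ℕ → H →L[ℂ] H}

theorem IsFormSpace.re_inner_potential_le {hDA : D ≤ A.domain} {hDV : D ≤ V.domain}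
    (hE : IsFormSpace (A.domRestrict D) (-η) ι j) (hη : η < 0)
    (hA0 : BoundedBelowBy A 0) (ha : 0 < a) (hb : 0 < b)
    (hVA : ∀ (f : H) (hf : f ∈ D),
      (inner ℂ (V ⟨f, hDV hf⟩) f).re ≤ a * (inner ℂ (A ⟨f, hDA hf⟩) f).re + b * ‖f‖ ^ 2)
    (x : (A.domRestrict D).domain) :
    (inner ℂ (V ⟨x, hDV x.2.1⟩) (x : H)).re ≤ (a + b / -η) * ‖j x‖ ^ 2 := by
  have h1 := hVA x x.2.1
  have h2 := hA0 ⟨x, x.2.2⟩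
  have h3 : ‖j x‖ ^ 2 = (inner ℂ (A ⟨x, x.2.2⟩) (x : H)).re + -η * ‖(x : H)‖ ^ 2 := hE.norm_sq x
  dsimp only at h1 h2
  rw [zero_mul] at h2
  set s := (inner ℂ (A ⟨x, x.2.2⟩) (x : H)).re
  have hη' : 0 < -η := by linarith
  have h4 : (a + b / -η) * (s + -η * ‖(x : H)‖ ^ 2) =
      a * s + b * ‖(x : H)‖ ^ 2 + (a * (-η) * ‖(x : H)‖ ^ 2 + b / -η * s) := by
    linear_combination ‖(x : H)‖ ^ 2 * div_mul_cancel₀ b hη'.ne'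
  rw [h3, h4]
  have : 0 ≤ a * (-η) * ‖(x : H)‖ ^ 2 + b / -η * s := by positivity
  linarith

/-- On `D` this is `V_n ≤ V`; since `V_n` is bounded, both sides are continuous on `E` and density
extends it. -/
theorem IsFormSpace.re_inner_regularizing_le {hDV : D ≤ V.domain}
    (hE : IsFormSpace (A.domRestrict D) (-η) ι j) {c : ℝ}
    (hV : ∀ x : (A.domRestrict D).domain,
      (inner ℂ (V ⟨x, hDV x.2.1⟩) (x : H)).re ≤ c * ‖j x‖ ^ 2)
    (hVn : IsRegularizing V D Vn) (n : ℕ) (e : E) :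
    (inner ℂ (Vn n (ι e)) (ι e)).re ≤ c * ‖e‖ ^ 2 := by
  refine hE.induction_le (p := fun e => (inner ℂ (Vn n (ι e)) (ι e)).re)
    (q := fun e => c * ‖e‖ ^ 2) (Complex.continuous_re.comp (by fun_prop)) (by fun_prop)
    (fun x => ?_) e
  rw [hE.embed]
  exact (hVn.le n ⟨x, hDV x.2.1⟩).trans (hV x)

/-- The forms `(V_m u, φ)`, `u = ι e`, approximate `(u, V φ)`. -/
theorem IsFormSpace.norm_inner_regularizing_sub_le {hDV : D ≤ V.domain}
    (hE : IsFormSpace (A.domRestrict D) (-η) ι j) (hVs : V.IsFormalAdjoint V) {c : ℝ}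
    (hV : ∀ x : (A.domRestrict D).domain,
      (inner ℂ (V ⟨x, hDV x.2.1⟩) (x : H)).re ≤ c * ‖j x‖ ^ 2)
    (hVn : IsRegularizing V D Vn) (m : ℕ) (φ : (A.domRestrict D).domain) (e : E) :
    ‖inner ℂ (Vn m (ι e)) (φ : H) - inner ℂ (ι e) (V ⟨φ, hDV φ.2.1⟩)‖ ^ 2 ≤
      c * ‖e‖ ^ 2 * ((inner ℂ (V ⟨φ, hDV φ.2.1⟩) (φ : H)).re - (inner ℂ (Vn m φ) (φ : H)).re) := by
  refine hE.induction_le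
    (p := fun e => ‖inner ℂ (Vn m (ι e)) (φ : H) - inner ℂ (ι e) (V ⟨φ, hDV φ.2.1⟩)‖ ^ 2)
    (q := fun e => c * ‖e‖ ^ 2 *
      ((inner ℂ (V ⟨φ, hDV φ.2.1⟩) (φ : H)).re - (inner ℂ (Vn m φ) (φ : H)).re))
    (by fun_prop) (by fun_prop) (fun x => ?_) e
  rw [hE.embed]
  let i : (A.domRestrict D).domain →ₗ[ℂ] H := (A.domRestrict D).domain.subtype
  -- `V - V_m` is nonnegative on `D`; Cauchy-Schwarz for its form gives the estimate.
  let S : (A.domRestrict D).domain →ₗ[ℂ] H :=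
    V.toFun ∘ₗ Submodule.inclusion (inf_le_left.trans hDV) - (Vn m).toLinearMap ∘ₗ i
  have hS : ∀ x, S x = V ⟨x, hDV x.2.1⟩ - Vn m x := fun x => rfl
  have hi : ∀ x, i x = x := fun x => rfl
  have hVs' : ∀ x y : (A.domRestrict D).domain,
      inner ℂ (V ⟨x, hDV x.2.1⟩) (y : H) = inner ℂ (x : H) (V ⟨y, hDV y.2.1⟩) :=
    fun x y => hVs ⟨x, hDV x.2.1⟩ ⟨y, hDV y.2.1⟩
  have hms : ∀ x y : H, inner ℂ (Vn m x) y = inner ℂ x (Vn m y) := (hVn.nonneg m).isSymmetric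
  have hval : ∀ x, (inner ℂ (S x) (i x)).re =
      (inner ℂ (V ⟨x, hDV x.2.1⟩) (x : H)).re - (inner ℂ (Vn m x) (x : H)).re := fun x => by
    rw [hS, hi, inner_sub_left, Complex.sub_re]
  have hnn : ∀ x, 0 ≤ (inner ℂ (S x) (i x)).re := fun x => by
    rw [hval]
    exact sub_nonneg.2 (hVn.le m ⟨x, hDV x.2.1⟩)
  have h := norm_inner_sq_le S i (fun x y => by
    rw [hS, hS, hi, hi, inner_sub_left, inner_sub_right, hVs', hms]) hnn x φ
  have h1 : ‖inner ℂ (Vn m x) (φ : H) - inner ℂ (x : H) (V ⟨φ, hDV φ.2.1⟩)‖ =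
      ‖inner ℂ (S x) (i φ)‖ := by
    rw [hS, hi, inner_sub_left, hVs', norm_sub_rev]
  rw [h1]
  refine h.trans ?_
  rw [← hval φ]
  refine mul_le_mul_of_nonneg_right ?_ (hnn φ)
  rw [hval]
  have : 0 ≤ (inner ℂ (Vn m x) (x : H)).re := (hVn.nonneg m).re_inner_nonneg_left x
  linarith [hV x]

theorem IsRegularizing.le_of_le (hVn : IsRegularizing V D Vn) {m n : ℕ} (h : m ≤ n) (f : H) :
    (inner ℂ (Vn m f) f).re ≤ (inner ℂ (Vn n f) f).re :=
  monotone_nat_of_le_succ (f := fun n => (inner ℂ (Vn n f) f).re) (fun n => hVn.mono n f) h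

/-- Cauchy-Schwarz for `V_n - V_m ≥ 0`. It replaces `V_n` by a fixed `V_m` with an error uniform in
`n`, small for large `m` when `φ ∈ D`. -/
theorem IsRegularizing.norm_inner_sub_le (hVn : IsRegularizing V D Vn) {m n : ℕ} (h : m ≤ n)
    (u φ : H) :
    ‖inner ℂ (Vn n u) φ - inner ℂ (Vn m u) φ‖ ^ 2 ≤
      (inner ℂ (Vn n u) u).re * ((inner ℂ (Vn n φ) φ).re - (inner ℂ (Vn m φ) φ).re) := by
  have hsym : ∀ n, ∀ x y : H, inner ℂ (Vn n x) y = inner ℂ x (Vn n y) :=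
    fun n => (hVn.nonneg n).isSymmetric
  have hval : ∀ x, (inner ℂ ((Vn n - Vn m) x) x).re =
      (inner ℂ (Vn n x) x).re - (inner ℂ (Vn m x) x).re := fun x => by
    rw [_root_.sub_apply, inner_sub_left, Complex.sub_re]
  have hnn : ∀ x, 0 ≤ (inner ℂ ((Vn n - Vn m) x) x).re := fun x => by
    rw [hval]
    exact sub_nonneg.2 (hVn.le_of_le h x)
  have h1 := SingularPerturbation.norm_inner_sq_le (Vn n - Vn m).toLinearMap LinearMap.id
    (fun x y => by
      change inner ℂ ((Vn n - Vn m) x) y = inner ℂ x ((Vn n - Vn m) y)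
      rw [_root_.sub_apply, _root_.sub_apply, inner_sub_left, inner_sub_right, hsym, hsym]) hnn u φ
  change ‖inner ℂ ((Vn n - Vn m) u) φ‖ ^ 2 ≤
    (inner ℂ ((Vn n - Vn m) u) u).re * (inner ℂ ((Vn n - Vn m) φ) φ).re at h1
  rw [hval φ, hval u, _root_.sub_apply, inner_sub_left] at h1
  refine h1.trans (mul_le_mul_of_nonneg_right ?_ (sub_nonneg.2 (hVn.le_of_le h φ)))
  have : 0 ≤ (inner ℂ (Vn m u) u).re := (hVn.nonneg m).re_inner_nonneg_left u
  linarith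

/-- Weak limits of sequences with bounded potential energy have finite potential energy. -/
theorem IsRegularizing.re_inner_le_of_weak_limit (hVn : IsRegularizing V D Vn) {l : Filter ℕ}
    [l.NeBot] (hl : l ≤ atTop) {u : ℕ → H} {w : H} {C : ℝ} (hC : 0 ≤ C)
    (hu : ∀ n, (inner ℂ (Vn n (u n)) (u n)).re ≤ C)
    (hw : ∀ y, Tendsto (fun n => inner ℂ (u n) y) l (𝓝 (inner ℂ w y))) (m : ℕ) :
    (inner ℂ (Vn m w) w).re ≤ C := by
  have hsym : ∀ x y : H, inner ℂ (Vn m x) y = inner ℂ x (Vn m y) := (hVn.nonneg m).isSymmetric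
  set t := (inner ℂ (Vn m w) w).re with ht
  have ht0 : 0 ≤ t := (hVn.nonneg m).re_inner_nonneg_left w
  have h1 : Tendsto (fun n => ‖inner ℂ (Vn m (u n)) w‖ ^ 2) l (𝓝 (‖inner ℂ (Vn m w) w‖ ^ 2)) := by
    simp only [hsym]
    exact (hw (Vn m w)).norm.pow 2
  -- Cauchy-Schwarz in the limit gives `t² ≤ C t`, which forces `t ≤ C`.
  have h2 : ∀ᶠ n in l, ‖inner ℂ (Vn m (u n)) w‖ ^ 2 ≤ C * t := by
    filter_upwards [hl (eventually_ge_atTop m)] with n hn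
    refine ((hVn.nonneg m).norm_inner_sq_le (u n) w).trans ?_
    exact mul_le_mul_of_nonneg_right ((hVn.le_of_le hn _).trans (hu n)) ht0
  have h3 := le_of_tendsto h1 h2
  have h4 : t ^ 2 ≤ ‖inner ℂ (Vn m w) w‖ ^ 2 := by
    gcongr
    exact Complex.re_le_norm _
  by_contra! hlt
  nlinarith

/-- Passing to the limit in the potential term. -/
theorem IsFormSpace.limit_eq_inner_potential {hDV : D ≤ V.domain}
    (hE : IsFormSpace (A.domRestrict D) (-η) ι j) (hVs : V.IsFormalAdjoint V) {c : ℝ}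
    (hV : ∀ x : (A.domRestrict D).domain,
      (inner ℂ (V ⟨x, hDV x.2.1⟩) (x : H)).re ≤ c * ‖j x‖ ^ 2)
    (hVn : IsRegularizing V D Vn) {l : Filter ℕ} [l.NeBot] (hl : l ≤ atTop) {u : ℕ → H} {e : E}
    {C : ℝ} (hu : ∀ n, (inner ℂ (Vn n (u n)) (u n)).re ≤ C)
    (hw : ∀ y, Tendsto (fun n => inner ℂ (u n) y) l (𝓝 (inner ℂ (ι e) y)))
    (φ : (A.domRestrict D).domain) {L : ℂ}
    (hL : Tendsto (fun n => inner ℂ (Vn n (u n)) (φ : H)) l (𝓝 L)) :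
    L = inner ℂ (ι e) (V ⟨φ, hDV φ.2.1⟩) := by
  set ε : ℕ → ℝ := fun m =>
    (inner ℂ (V ⟨φ, hDV φ.2.1⟩) (φ : H)).re - (inner ℂ (Vn m φ) (φ : H)).re with hε
  have hε0 : Tendsto ε atTop (𝓝 0) := by
    have := (hVn.tendsto ⟨φ, hDV φ.2.1⟩ φ.2.1).const_sub
      (inner ℂ (V ⟨φ, hDV φ.2.1⟩) (φ : H)).re
    rwa [sub_self] at this
  have hlim : ∀ {x : ℕ → ℂ} {y : ℂ} {k : ℝ}, (∀ m, ‖x m - y‖ ^ 2 ≤ k * ε m) →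
      Tendsto x atTop (𝓝 y) := by
    intro x y k hk
    have h1 := hε0.const_mul k
    rw [mul_zero] at h1
    have h2 : Tendsto (fun m => ‖x m - y‖ ^ 2) atTop (𝓝 0) :=
      squeeze_zero (fun m => sq_nonneg _) hk h1
    rw [tendsto_iff_norm_sub_tendsto_zero]
    have := (Real.continuous_sqrt.tendsto 0).comp h2
    rw [Real.sqrt_zero] at this
    exact this.congr fun n => Real.sqrt_sq (norm_nonneg _)
  have h1 : Tendsto (fun m => inner ℂ (Vn m (ι e)) (φ : H)) atTop
      (𝓝 (inner ℂ (ι e) (V ⟨φ, hDV φ.2.1⟩))) :=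
    hlim (fun m => hE.norm_inner_regularizing_sub_le hVs hV hVn m φ e)
  -- Two limits of `(V_m ι e, φ)` as `m → ∞` are compared; the second is obtained by first letting
  -- `n` run along `l` with `m` fixed.
  refine tendsto_nhds_unique (hlim (k := C) fun m => ?_) h1
  have hsym : ∀ x y : H, inner ℂ (Vn m x) y = inner ℂ x (Vn m y) := (hVn.nonneg m).isSymmetric
  have h2 : Tendsto (fun n => inner ℂ (Vn m (u n)) (φ : H)) l
      (𝓝 (inner ℂ (Vn m (ι e)) (φ : H))) := by
    simp only [hsym]
    exact hw _
  rw [norm_sub_rev]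
  refine le_of_tendsto ((hL.sub h2).norm.pow 2) ?_
  filter_upwards [hl (eventually_ge_atTop m)] with n hn
  refine (hVn.norm_inner_sub_le hn _ _).trans ?_
  have h3 : (inner ℂ (Vn n φ) (φ : H)).re - (inner ℂ (Vn m φ) (φ : H)).re ≤ ε m :=
    sub_le_sub_right (hVn.le n ⟨φ, hDV φ.2.1⟩) _
  have h4 : 0 ≤ (inner ℂ (Vn n φ) (φ : H)).re - (inner ℂ (Vn m φ) (φ : H)).re :=
    sub_nonneg.2 (hVn.le_of_le hn φ)
  have h5 : 0 ≤ (inner ℂ (Vn n (u n)) (u n)).re := (hVn.nonneg n).re_inner_nonneg_left _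
  exact mul_le_mul (hu n) h3 h4 (h5.trans (hu n))

/-- The form of `A - α V` is bounded by a multiple of the `E`-norm squared, so `E`-convergent
sequences from `D` are also Cauchy for it. -/
theorem IsFormSpace.mem_formDomain_singularOp {hDV : D ≤ V.domain}
    (hE : IsFormSpace (A.domRestrict D) (-η) ι j) (hη : η < 0) (hA0 : BoundedBelowBy A 0)
    (hV0 : BoundedBelowBy V 0) {c : ℝ}
    (hV : ∀ x : (A.domRestrict D).domain,
      (inner ℂ (V ⟨x, hDV x.2.1⟩) (x : H)).re ≤ c * ‖j x‖ ^ 2) {α : ℝ} (hα : 0 ≤ α) (e : E) :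
    ι e ∈ formDomain (singularOp A V D α) := by
  obtain ⟨u, hu⟩ := hE.exists_tendsto e
  refine Submodule.subset_span
    ⟨fun n => ⟨u n, (u n).2.1, (u n).2.2, hDV (u n).2.1⟩, (hE.formApprox_of_tendsto hu).1, ?_⟩
  have h2 : Tendsto (fun p : ℕ × ℕ => j (u p.1) - j (u p.2)) atTop (𝓝 (e - e)) := by
    rw [← prod_atTop_atTop_eq]
    exact (hu.comp tendsto_fst).sub (hu.comp tendsto_snd)
  have h3 := (h2.norm.pow 2).const_mul (1 + α * c)
  simp only [sub_self, norm_zero, ne_eq, OfNat.ofNat_ne_zero, not_false_eq_true, zero_pow,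
    mul_zero] at h3
  refine squeeze_zero_norm (fun p => ?_) h3
  rw [← _root_.map_sub, re_inner_singularOp, Real.norm_eq_abs]
  set x := u p.1 - u p.2 with hx
  have h4 := hV x
  have h5 : ‖j x‖ ^ 2 = (inner ℂ (A ⟨x, x.2.2⟩) (x : H)).re + -η * ‖(x : H)‖ ^ 2 := hE.norm_sq x
  have h6 := hA0 ⟨x, x.2.2⟩
  have h7 := hV0 ⟨x, hDV x.2.1⟩
  dsimp only at h6 h7
  rw [zero_mul] at h6 h7
  have h8 : 0 ≤ -η * ‖(x : H)‖ ^ 2 := mul_nonneg (by linarith) (sq_nonneg _)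
  change |(inner ℂ (A ⟨x, x.2.2⟩) (x : H)).re - α * (inner ℂ (V ⟨x, hDV x.2.1⟩) (x : H)).re| ≤ _
  have h9 := mul_le_mul_of_nonneg_left h4 hα
  have h10 := mul_nonneg hα h7
  rw [abs_le]
  constructor <;> nlinarith [sq_nonneg ‖j x‖]

end Convergence

/-- Strong resolvent convergence for an extension with bounded form `q`. -/
theorem exists_strongResolventConvergence [CompleteSpace H] {A V : H →ₗ.[ℂ] H}
    (hA : IsSelfAdjoint A) (hA0 : BoundedBelowBy A 0)
    (hV : IsSelfAdjoint V) (hV0 : BoundedBelowBy V 0)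
    {D : Submodule ℂ H} (hDA : D ≤ A.domain) (hDV : D ≤ V.domain) (hD : Dense (D : Set H))
    {a b : ℝ} (ha : 0 < a) (hb : 0 < b)
    (hVA : ∀ (f : H) (hf : f ∈ D),
      (inner ℂ (V ⟨f, hDV hf⟩) f).re ≤ a * (inner ℂ (A ⟨f, hDA hf⟩) f).re + b * ‖f‖ ^ 2)
    {Vn : ℕ → H →L[ℂ] H} (hVn : IsRegularizing V D Vn)
    (hadm : IsAdmissible (A.domRestrict D) Vn)
    {η : ℝ} (hη : η < 0) {B : H →ₗ.[ℂ] H} {q : NonnegForm H}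
    (hB : IsSelfAdjointExtension (A.domRestrict D) η B)
    (hq : CorrespondsTo (A.domRestrict D) η B q) (hcl : IsClosed (q.domain : Set H)) :
    ∃ α₀ : ℝ, 0 < α₀ ∧ ∀ α : ℝ, 0 < α → α < α₀ →
      StrongResolventConvergence (fun n => subBounded B α (Vn n))
        (friedrichs (singularOp A V D α)) := by
  have hAs := isFormalAdjoint_of_isSelfAdjoint hA
  have hVs := isFormalAdjoint_of_isSelfAdjoint hV
  have hBs := isFormalAdjoint_of_isSelfAdjoint hB.selfAdjoint
  set T := A.domRestrict D with hTdef
  have hT : Dense (T.domain : Set H) := by rwa [hTdef, domRestrict_domain_eq hDA]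
  have hTs : T.IsFormalAdjoint T := domRestrict_isFormalAdjoint hAs
  have hT0 : BoundedBelowBy T 0 := domRestrict_boundedBelow hA0
  obtain ⟨E, _, _, _, ι, j, hE⟩ := exists_isFormSpace (κ := -η) hTs hT0 (by linarith)
  obtain ⟨Q, hQ, hdec⟩ := hq.exists_decomposition hT hE hB hcl
  set c := a + b / -η with hc
  have hη' : 0 < -η := by linarith
  have hc0 : 0 < c := by positivity
  have hVc := hE.re_inner_potential_le hη hA0 ha hb hVA
  have hVnc := hE.re_inner_regularizing_le hVc hVn
  have hk0 : 0 < 4 * c * (1 + 2 * (Q / -η)) := by positivity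
  -- This threshold is the smallness needed for absorption; since `a ≤ c`, it also gives `α a ≤ 1`
  -- and hence semiboundedness of `A - α V`.
  refine ⟨(4 * c * (1 + 2 * (Q / -η)))⁻¹, inv_pos.2 hk0, fun α hα hα' z hz => ?_⟩
  have hsmall : α * c * (1 + 2 * (Q / -η)) ≤ 1 / 4 := by
    have := mul_le_mul_of_nonneg_right hα'.le hk0.le
    rw [inv_mul_cancel₀ hk0.ne'] at this
    linarith
  have haα : α * a ≤ 1 := by
    have h1 : a ≤ c := by rw [hc]; linarith [div_pos hb hη']
    have h2 : 1 ≤ 1 + 2 * (Q / -η) := by linarith [div_nonneg hQ hη'.le]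
    have h3 : α * a ≤ α * c := by gcongr
    have h4 : α * c * 1 ≤ α * c * (1 + 2 * (Q / -η)) := by gcongr
    linarith
  have hSd : Dense ((singularOp A V D α).domain : Set H) := by
    rwa [singularOp_domain_eq hDA hDV]
  have hSs := singularOp_isFormalAdjoint (D := D) hAs hVs α
  have hSb := singularOp_boundedBelow hA0 hα.le haα hVA
  have hFs := isFormalAdjoint_of_isSelfAdjoint (friedrichs_isSelfAdjoint hSd hSs hSb)
  have hBn : ∀ n, (subBounded B α (Vn n)).IsFormalAdjoint (subBounded B α (Vn n)) := fun n =>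
    isFormalAdjoint_of_isSelfAdjoint (subBounded_isSelfAdjoint hB.selfAdjoint α (hVn.nonneg n))
  choose R hR using fun n => exists_resolvent_subBounded hB.selfAdjoint hB.bound hα.le
    (hVn.nonneg n) hz
  obtain ⟨R', hR'⟩ := exists_resolvent_friedrichs hSd hSs hSb hz
  refine ⟨R, R', hR, hR', fun f => tendsto_resolvent_of_weak hz hBn hFs hR hR' fun y => ?_⟩
  have hRM : ∀ n, ‖R n f‖ ≤ ‖f‖ / |z.im| := fun n => by
    rw [le_div_iff₀ (abs_pos.2 hz), mul_comm]
    exact (hR n).norm_le (hBn n) f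
  obtain ⟨C, hC0, hC⟩ := exists_a_priori_bound hη (hE.norm_embed_sq_le hT0) hQ hα hc0 hsmall z f
    (‖f‖ / |z.im|)
  have hsol : ∀ n, ∃ u : B.domain, (u : H) = R n f ∧
      B u = f + (α : ℂ) • Vn n (R n f) + z • R n f := by
    intro n
    obtain ⟨x, hx, hf⟩ := (hR n).1 f
    have := mem_graph_subBounded_iff.1 ((subBounded B α (Vn n)).mem_graph x)
    obtain ⟨u, hu1, hu2⟩ := B.mem_graph_iff.1 this
    dsimp only at hu1 hu2
    refine ⟨u, hu1.trans hx, ?_⟩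
    rw [hx] at hf hu2
    rw [hu2, sub_eq_iff_eq_add.1 hf]
    abel
  choose u hu hBu using hsol
  choose g h s hh hgh hsQ hen hen' using fun n => hdec (u n)
  have hbounds := fun n => hC (Vn n) (u n) (B (u n)) (h n) (g n) (s n) (hVn.nonneg n) (hVnc n)
    (hgh n) (hsQ n) (hen n) (hen' n) (by rw [hu]; exact hBu n) (by rw [hu]; exact hRM n)
  have hgb : ∀ n, ‖g n‖ ≤ Real.sqrt C := fun n => Real.le_sqrt_of_sq_le (hbounds n).1
  have hhb : ∀ n, ‖h n‖ ≤ Real.sqrt C := fun n => Real.le_sqrt_of_sq_le (hbounds n).2.1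
  -- The limit found below is `R' f` for every ultrafilter, so the whole sequence converges.
  rw [tendsto_iff_ultrafilter]
  intro l hl
  obtain ⟨e, he⟩ := exists_weak_limit l hgb
  obtain ⟨k, hk⟩ := exists_weak_limit l hhb
  have hweak : ∀ y, Tendsto (fun n => inner ℂ (u n : H) y) l (𝓝 (inner ℂ (ι e + k) y)) := by
    intro y
    have h1 := (he (ι.adjoint y)).add (hk y)
    simp only [ContinuousLinearMap.adjoint_inner_right, ← inner_add_left] at h1
    exact h1.congr fun n => by rw [hgh n]
  have hlim := hVn.re_inner_le_of_weak_limit hl hC0 (fun n => (hbounds n).2.2) hweak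
  -- Both `ι e + k` and `ι e` have bounded potential energy, hence so does `k`.
  have hk0 : k = 0 := by
    refine hadm.eq_zero hT hTs hT0 hE hVn.nonneg hVnc (mem_deficiencySpace_of_weak_limit hT hh hk)
      (C := 2 * C + 2 * (c * ‖-e‖ ^ 2)) fun n => ?_
    have h1 := (hVn.nonneg n).re_inner_add_le (ι e + k) (ι (-e))
    rw [_root_.map_neg, add_neg_cancel_comm] at h1
    have h2 := hVnc n (-e)
    rw [_root_.map_neg, ← hc] at h2
    linarith [hlim n]
  simp only [hk0, add_zero] at hweak
  have hgraph : (ι e, f + z • ι e) ∈ (friedrichs (singularOp A V D α)).graph := by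
    rw [friedrichs, mem_graph_domRestrict_iff]
    refine ⟨hE.mem_formDomain_singularOp hη hA0 hV0 hVc hα.le e, ?_⟩
    rw [mem_graph_adjoint_iff hSd]
    intro φ
    let φ' : T.domain := ⟨φ, φ.2.1, φ.2.2.1⟩
    have hαc : (α : ℂ) ≠ 0 := Complex.ofReal_ne_zero.2 hα.ne'
    -- `B` extends `T`, so `(B u_n, φ) = (u_n, A φ)`; solving the equation for the potential term
    -- leaves only weakly convergent quantities.
    have heq : ∀ n, inner ℂ (Vn n (u n)) (φ : H) = (α : ℂ)⁻¹ *
        (inner ℂ (u n : H) (A ⟨φ, φ.2.2.1⟩) - inner ℂ f (φ : H) -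
          conj z * inner ℂ (u n : H) (φ : H)) := by
      intro n
      have hφB : (φ : H) ∈ B.domain := hB.extends_le.1 φ'.2
      have h1 := hBs (u n) ⟨φ, hφB⟩
      have h2 : B ⟨φ, hφB⟩ = A ⟨φ, φ.2.2.1⟩ :=
        (hB.extends_le.2 (x := φ') (y := ⟨φ, hφB⟩) rfl).symm
      dsimp only at h1
      rw [h2, hBu, inner_add_left, inner_add_left, inner_smul_left, inner_smul_left,
        Complex.conj_ofReal, ← hu] at h1
      rw [← h1]
      field_simp
      ring
    have hL : Tendsto (fun n => inner ℂ (Vn n (u n)) (φ : H)) l (𝓝 ((α : ℂ)⁻¹ *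
        (inner ℂ (ι e) (A ⟨φ, φ.2.2.1⟩) - inner ℂ f (φ : H) -
          conj z * inner ℂ (ι e) (φ : H)))) := by
      simp only [heq]
      exact ((((hweak _).sub_const _).sub ((hweak _).const_mul _)).const_mul _)
    have hlimit := hE.limit_eq_inner_potential hVs hVc hVn hl (fun n => (hbounds n).2.2) hweak φ' hL
    rw [singularOp_apply, inner_sub_right, inner_smul_right, inner_add_left, inner_smul_left]
    change _ = _ - (α : ℂ) * inner ℂ (ι e) (V ⟨φ', hDV φ'.2.1⟩)
    rw [← hlimit]
    field_simp
    ring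
  have hR'f : R' f = ι e := by
    obtain ⟨x, hx, hx'⟩ := LinearPMap.mem_graph_iff _ |>.1 hgraph
    dsimp only at hx hx'
    have := hR'.2 x
    rwa [hx', hx, add_sub_cancel_right] at this
  rw [hR'f]
  exact (hweak y).congr fun n => by rw [hu]

end Perturbation

end SingularPerturbation

theorem mainTheorem2 {H : Type*} [NormedAddCommGroup H] [InnerProductSpace ℂ H] [CompleteSpace H]
    [TopologicalSpace.SeparableSpace H]
    (A V : H →ₗ.[ℂ] H)
    (hA : IsSelfAdjoint A) (hA0 : BoundedBelowBy A 0)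
    (hV : IsSelfAdjoint V) (hV0 : BoundedBelowBy V 0)
    (D : Submodule ℂ H) (hDA : D ≤ A.domain) (hDV : D ≤ V.domain) (hD : Dense (D : Set H))
    (a b : ℝ) (ha : 0 < a) (hb : 0 < b)
    (hVA : ∀ (f : H) (hf : f ∈ D),
      (inner ℂ (V ⟨f, hDV hf⟩) f).re ≤ a * (inner ℂ (A ⟨f, hDA hf⟩) f).re + b * ‖f‖ ^ 2)
    (Vn : ℕ → H →L[ℂ] H) (hVn : IsRegularizing V D Vn)
    (hadm : IsAdmissible (A.domRestrict D) Vn)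
    (η : ℝ) (hη : η < 0) :
    (∀ (B : H →ₗ.[ℂ] H) (q : NonnegForm H),
      IsSelfAdjointExtension (A.domRestrict D) η B →
      CorrespondsTo (A.domRestrict D) η B q →
      IsClosed (q.domain : Set H) →
      ∃ α₀ : ℝ, 0 < α₀ ∧ ∀ α : ℝ, 0 < α → α < α₀ →
        StrongResolventConvergence (fun n => subBounded B α (Vn n))
          (friedrichs (singularOp A V D α))) ∧
    (∃ K : H →ₗ.[ℂ] H, IsKreinExtension (A.domRestrict D) η K) ∧
    (∀ K : H →ₗ.[ℂ] H, IsKreinExtension (A.domRestrict D) η K →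
      ∃ α₀ : ℝ, 0 < α₀ ∧ ∀ α : ℝ, 0 < α → α < α₀ →
        StrongResolventConvergence (fun n => subBounded K α (Vn n))
          (friedrichs (singularOp A V D α))) := by
  have hAs := isFormalAdjoint_of_isSelfAdjoint hA
  have hT : Dense ((A.domRestrict D).domain : Set H) := by rwa [domRestrict_domain_eq hDA]
  refine ⟨fun B q hB hq hcl => exists_strongResolventConvergence hA hA0 hV hV0 hDA hDV hD ha hb hVA
    hVn hadm hη hB hq hcl, exists_isKreinExtension hT (domRestrict_isFormalAdjoint hAs)
    (domRestrict_boundedBelow hA0) hη, fun K hK => ?_⟩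
  exact exists_strongResolventConvergence hA hA0 hV hV0 hDA hDV hD ha hb hVA hVn hadm hη
    hK.extension hK.corresponds (isClosed_deficiencySpace hT)
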